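/- Setting. Let $\mathbb T^d=\mathbb R^d/\mathbb Z^d$ with Lebesgue measure $m$, let $T\in C^\infty(\mathbb T^d,\mathbb T^d)$, $\alpha\in C^\infty(\mathbb T^d,\mathbb R)$, $\beta\in C^\infty(\mathbb T^d,\mathbb R^d)$, and let $\bar r>12$ be an integer. Write $\int\varphi h:=h(\varphi)$ for $h\in C^{\bar r}(\mathbb T^d,\mathbb R)'$. For $\nu\in\mathbb R$ put $T_{\nu,h}(x)=T(x)+\nu\beta(x)\int\alpha h \pmod 1$. For a $C^{\bar r}$ map $S$ of the torus, the transfer operator $\mathcal L_S$ is defined by $\int g\,\mathcal L_S h=\int (g\circ S)\,h$ for $g\in C^{\bar r}$. Put $\widetilde{\mathcal L}_\nu h=\mathcal L_{T_{\nu,h}}h$. Let $\nu_*>0$ and let $\mathcal T\subset C^{\bar r}(\mathbb T^d,\mathbb T^d)$ be a set of surjective maps, closed under composition, with $T_{\nu,\mu}\in\mathcal T$ for all $\nu\in[0,\nu_*]$ and all probability measures $\mu$. Let $\mathcal B_0\supset\mathcal B_1\supset\mathcal B_2\supset\mathcal B_3$ be real Banach spaces, continuously embedded in $C^{\bar r}(\mathbb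 T^d,\mathbb R)'$, with $\|\cdot\|_{\mathcal B_i}\le\|\cdot\|_{\mathcal B_{i+1}}$, with $C^{\bar r}(\mathbb T^d,\mathbb R)\subset\mathcal B_3$ (through $f\mapsto f\,m$), and with $C^{\bar r}(\mathbb T^d,\mathbb R)$ dense in each $\mathcal B_i$ and in each dual $\mathcal B_i'$. Put $\mathbb V=\{f\in\mathcal B_1:\int f=0\}$. Assume that there are $K,C_*\ge1$, $\bar c,\hat c>0$ and $\vartheta\in(0,1)$ such that: 1. for each $S\in\mathcal T$, $\mathcal L_S$ is a bounded operator on $\mathcal B_i$, $0\le i\le 3$; 2. each $\partial_{x_k}$ is a bounded operator from $\mathcal B_{i+1}$ to $\mathcal B_i$, $0\le i\le2$; 3. $\|ah\|_{\mathcal B_i}\le C_*\|a\|_{C^{\bar ci+\hat c}}\|h\|_{\mathcal B_i}$ for $h\in\mathcal B_i$, $0\le i\le 3$, and $a\in C^{\bar r}\cap C^{\bar ci+\hat c}$, and $|\int h|\le C_*\|h\|_{\mathcal B_0}$ for $h\in\mathcal B_0$; 4. the unit ball of $\mathcal B_{i+1}$ is relatively compact in $\mathcal B_i$, $0\le i\le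 2$; 5. for all $n$ and $S_1,\dots,S_n\in\mathcal T$: $\|\mathcal L_{S_n}\cdots\mathcal L_{S_1}\phi\|_{\mathcal B_0}\le C_*\|\phi\|_{\mathcal B_0}$ for $\phi\in\mathcal B_0$, and $\|\mathcal L_{S_n}\cdots\mathcal L_{S_1}\phi\|_{\mathcal B_i}\le C_*\vartheta^n\|\phi\|_{\mathcal B_i}+K\|\phi\|_{\mathcal B_{i-1}}$ for $\phi\in\mathcal B_i$, $1\le i\le3$; 6. there is $\bar n$ such that $\|\mathcal L_{S_n}\cdots\mathcal L_{S_1}|_{\mathbb V\cap\mathcal B_i}\|_{\mathcal B_i}<\vartheta^n$ for all $n\ge\bar n$, $S_1,\dots,S_n\in\mathcal T$ and $1\le i\le3$. For $K_\star>0$ let $\mathbb W=\{h\in\mathcal B_1:\|h\|_{\mathcal B_1}\le K_\star,\ h\ge0,\ \int h=1\}$. For $\nu\in[0,\nu_*]$ and $h\in\mathbb W$ let $H(\nu,h)\in\mathcal B_3$ be the unique invariant probability measure of $T_{\nu,h}$ in $\mathcal B_3$, i.e. $H\ge0$, $\int H=1$, $\mathcal L_{T_{\nu,h}}H=H$, and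 let $$\Theta(\nu,h)=-(\mathrm{Id}-\mathcal L_{T_{\nu,h}})^{-1}\sum_{k=1}^d\partial_{x_k}\mathcal L_{T_{\nu,h}}\bigl(\beta_kH(\nu,h)\bigr)\in\mathbb V,$$ where the inverse is that of the restriction of $\mathrm{Id}-\mathcal L_{T_{\nu,h}}$ to $\mathbb V$. Statement. For all large enough $K_\star$ the following holds. Let $\nu_0\in(0,\nu_*)$ and $h_0\in\mathbb W$ be such that $\widetilde{\mathcal L}_{\nu_0}h_0=h_0$ and $\nu_0\int\alpha\,\Theta(\nu_0,h_0)\ne1$. Then there exist an interval $[\nu_1,\nu_2]\subset[0,\nu_*]$ with $\nu_0\in(\nu_1,\nu_2)$ and a function $\mathbf h\in C^0([\nu_1,\nu_2],\mathcal B_1)\cap C^1((\nu_1,\nu_2),\mathcal B_1)$ such that $\mathbf h(\nu_0)=h_0$, such that $\mathbf h(\nu)\in\mathbb W$ and $\mathcal L_{T_{\nu,\mathbf h(\nu)}}\mathbf h(\nu)=\mathbf h(\nu)$ for all $\nu\in[\nu_1,\nu_2]$, and such that $\nu\int\alpha\,\Theta(\nu,\mathbf h(\nu))\ne1$ for all $\nu\in(\nu_1,\nu_2)$.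 Moreover, either $\nu_1=0$ or $\nu_1\int\alpha\,\Theta(\nu_1,\mathbf h(\nu_1))=1$, and either $\nu_2=\nu_*$ or $\nu_2\int\alpha\,\Theta(\nu_2,\mathbf h(\nu_2))=1$. -/

import Mathlib

open Set Topology MeasureTheory
open scoped ContDiff BoundedContinuousFunction

noncomputable section

namespace MeanFieldMaps

/-! ### The torus, functions and maps of class `C^n` on it -/

/-- The torus `𝕋^d = ℝ^d / ℤ^d`. -/
abbrev Torus (d : ℕ) : Type := UnitAddTorus (Fin d)

/-- `ℝ^d` with the Euclidean norm. -/
abbrev Euc (d : ℕ) : Type := EuclideanSpace ℝ (Fin d)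

variable {d r : ℕ}

/-- The projection `ℝ^d → 𝕋^d`. -/
def proj (x : Euc d) : Torus d := fun i => (x i : UnitAddCircle)

/-- The periodic function on `ℝ^d` given by a function on the torus. -/
def per {F : Type*} (f : Torus d → F) : Euc d → F := fun x => f (proj x)

lemma proj_surjective : Function.Surjective (proj : Euc d → Torus d) := by
  intro y
  choose x hx using fun i => QuotientAddGroup.mk_surjective (y i)
  exact ⟨WithLp.toLp 2 x, funext hx⟩

lemma proj_add (x y : Euc d) : proj (x + y) = proj x + proj y := by
  funext i; simp [proj]

/-- `C^n(𝕋^d, ℝ)`, as a space of functions. -/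
def CFun (d : ℕ) (n : WithTop ℕ∞) : Submodule ℝ (Torus d → ℝ) where
  carrier := {f | ContDiff ℝ n (per f)}
  add_mem' hf hg := ContDiff.add hf hg
  zero_mem' := contDiff_const
  smul_mem' c _ hf := ContDiff.const_smul c hf

/-- A map of class `C^n` from the torus to itself: one that has a lift of class `C^n`
to `ℝ^d`. -/
@[ext]
structure TorusMap (d : ℕ) (n : WithTop ℕ∞) where
  toFun : Torus d → Torus d
  exists_lift : ∃ F : Euc d → Euc d, ContDiff ℝ n F ∧ ∀ x, proj (F x) = toFun (proj x)

/-- Composition `S₁ ∘ S₂`. -/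
def TorusMap.comp {n : WithTop ℕ∞} (S₁ S₂ : TorusMap d n) : TorusMap d n where
  toFun := S₁.toFun ∘ S₂.toFun
  exists_lift := by
    obtain ⟨F₁, h₁, e₁⟩ := S₁.exists_lift
    obtain ⟨F₂, h₂, e₂⟩ := S₂.exists_lift
    exact ⟨F₁ ∘ F₂, h₁.comp h₂, fun x => by simp [e₁, e₂]⟩

/-! ### The Banach space `C^r(𝕋^d, ℝ)` -/

/-- The space `C^r(𝕋^d, ℝ)`; it carries the `C^r` norm, see below. -/
def Cr (d r : ℕ) : Type := CFun d r

namespace Cr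

instance : AddCommGroup (Cr d r) := inferInstanceAs (AddCommGroup (CFun d r))
instance : Module ℝ (Cr d r) := inferInstanceAs (Module ℝ (CFun d r))
instance : CoeFun (Cr d r) (fun _ => Torus d → ℝ) := ⟨fun f => f.1⟩

lemma contDiff (f : Cr d r) : ContDiff ℝ r (per f) := f.2

lemma exists_bound (f : Cr d r) (j : ℕ) (hj : j ≤ r) :
    ∃ C, ∀ x, ‖iteratedFDeriv ℝ j (per f) x‖ ≤ C := by
  have hc : Continuous (iteratedFDeriv ℝ j (per f)) :=
    f.contDiff.continuous_iteratedFDeriv (by exact_mod_cast hj)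
  obtain ⟨C, hC⟩ := (isCompact_closedBall (0 : Euc d) (Real.sqrt d)).exists_bound_of_continuousOn
    hc.continuousOn
  refine ⟨C, fun x => ?_⟩
  let k : Euc d := WithLp.toLp 2 fun i => -(⌊x i⌋ : ℝ)
  have hk : proj k = 0 := by
    funext i
    show ((-(⌊x i⌋ : ℝ) : ℝ) : UnitAddCircle) = 0
    rw [AddCircle.coe_eq_zero_iff]
    exact ⟨-⌊x i⌋, by simp⟩
  have hper : (fun y => per (f : Torus d → ℝ) (y + k)) = per f := by
    funext y; simp [per, proj_add, hk]
  have h1 : iteratedFDeriv ℝ j (per f) x = iteratedFDeriv ℝ j (per f) (x + k) := by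
    rw [← iteratedFDeriv_comp_add_right (𝕜 := ℝ) (f := per (f : Torus d → ℝ)) j k x, hper]
  rw [h1]
  apply hC
  rw [mem_closedBall_zero_iff, EuclideanSpace.norm_eq]
  apply Real.sqrt_le_sqrt
  calc ∑ i, ‖(x + k) i‖ ^ 2 ≤ ∑ _i : Fin d, (1 : ℝ) := by
        refine Finset.sum_le_sum fun i _ => ?_
        have e : (x + k) i = Int.fract (x i) := by
          simp [k, Int.fract, sub_eq_add_neg]
        rw [e, Real.norm_of_nonneg (Int.fract_nonneg _)]
        have := Int.fract_lt_one (x i)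
        have := Int.fract_nonneg (x i)
        nlinarith
    _ = d := by simp

/-- Families `(u_j)_{j ≤ r}` of bounded continuous functions with values in the `j`-linear forms,
with the norm `max_j sup_x ‖u_j(x)‖`. -/
def JetSpace (d r : ℕ) : Type := (j : Fin (r + 1)) → (Euc d →ᵇ (Euc d [×(j : ℕ)]→L[ℝ] ℝ))

instance : NormedAddCommGroup (JetSpace d r) :=
  @Pi.normedAddCommGroup (Fin (r + 1)) (fun j => Euc d →ᵇ (Euc d [×(j : ℕ)]→L[ℝ] ℝ)) _
    (fun _ => inferInstance)

instance : NormedSpace ℝ (JetSpace d r) :=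
  inferInstanceAs (NormedSpace ℝ ((j : Fin (r + 1)) → (Euc d →ᵇ (Euc d [×(j : ℕ)]→L[ℝ] ℝ))))

/-- All derivatives of order at most `r`, as bounded continuous functions. -/
def jet : Cr d r →ₗ[ℝ] JetSpace d r where
  toFun f j := BoundedContinuousFunction.ofNormedAddCommGroup
    (iteratedFDeriv ℝ (j : ℕ) (per f))
    (f.contDiff.continuous_iteratedFDeriv (by exact_mod_cast Nat.lt_succ_iff.1 j.2))
    (f.exists_bound j (Nat.lt_succ_iff.1 j.2)).choose
    (f.exists_bound j (Nat.lt_succ_iff.1 j.2)).choose_spec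
  map_add' f g := by
    refine funext fun j => BoundedContinuousFunction.ext fun x => ?_
    have hj : ((j : ℕ) : WithTop ℕ∞) ≤ r := by exact_mod_cast Nat.lt_succ_iff.1 j.2
    exact iteratedFDeriv_add_apply (f.contDiff.of_le hj).contDiffAt (g.contDiff.of_le hj).contDiffAt
  map_smul' c f := by
    refine funext fun j => BoundedContinuousFunction.ext fun x => ?_
    have hj : ((j : ℕ) : WithTop ℕ∞) ≤ r := by exact_mod_cast Nat.lt_succ_iff.1 j.2
    exact iteratedFDeriv_const_smul_apply (a := c) (x := x) (f.contDiff.of_le hj).contDiffAt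

lemma jet_injective : Function.Injective (jet : Cr d r → JetSpace d r) := by
  intro f g h
  apply Subtype.ext
  funext y
  obtain ⟨x, rfl⟩ := proj_surjective y
  have h0 := congrArg (fun J : JetSpace d r => J ⟨0, Nat.succ_pos r⟩ x (fun i => i.elim0)) h
  have h1 : iteratedFDeriv ℝ 0 (per f) x (fun i => i.elim0) =
      iteratedFDeriv ℝ 0 (per g) x (fun i => i.elim0) := h0
  rwa [iteratedFDeriv_zero_apply, iteratedFDeriv_zero_apply] at h1

/-- The `C^r` norm `max_{j ≤ r} sup_x ‖D^j f(x)‖`. -/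
instance : NormedAddCommGroup (Cr d r) :=
  NormedAddCommGroup.induced (Cr d r) (JetSpace d r) (jet : Cr d r →ₗ[ℝ] JetSpace d r) jet_injective

instance : NormedSpace ℝ (Cr d r) :=
  NormedSpace.induced ℝ (Cr d r) (JetSpace d r) (jet : Cr d r →ₗ[ℝ] JetSpace d r)

/-- The constant function `1`. -/
def one : Cr d r := ⟨fun _ => 1, (contDiff_const : ContDiff ℝ r fun _ : Euc d => (1 : ℝ))⟩

/-- The product of two functions. -/
def mul (a f : Cr d r) : Cr d r := ⟨fun x => a x * f x, a.contDiff.mul f.contDiff⟩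

/-- The composition `g ∘ S`. -/
def comp (g : Cr d r) (S : TorusMap d r) : Cr d r := ⟨fun x => g (S.toFun x), by
  obtain ⟨F, hF, e⟩ := S.exists_lift
  have : per (fun x => g (S.toFun x)) = per g ∘ F := by
    funext x; simp [per, e]
  show ContDiff ℝ r (per fun x => g (S.toFun x))
  rw [this]
  exact g.contDiff.comp hF⟩

/-- A smooth function, as an element of `C^r`. -/
def ofSmooth (f : CFun d ∞) : Cr d r :=
  ⟨f.1, show ContDiff ℝ r (per f.1) from
    ContDiff.of_le (n := ∞) f.2 (by exact_mod_cast le_top)⟩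

/-- The inclusion of `C^{r+1}` in `C^r`. -/
def ofSucc (f : Cr d (r + 1)) : Cr d r :=
  ⟨f.1, show ContDiff ℝ r (per f.1) from f.contDiff.of_le (by exact_mod_cast Nat.le_succ r)⟩

/-- The partial derivative `∂f/∂x_k` of a function on the torus. -/
def partialFun (k : Fin d) (f : Torus d → ℝ) : Torus d → ℝ := fun y =>
  fderiv ℝ (per f) (Function.surjInv proj_surjective y) (EuclideanSpace.single k 1)

lemma per_partialFun (k : Fin d) (f : Torus d → ℝ) (x : Euc d) :
    per (partialFun k f) x = fderiv ℝ (per f) x (EuclideanSpace.single k 1) := by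
  set z := Function.surjInv proj_surjective (proj x) with hz
  have hzx : proj z = proj x := Function.surjInv_eq proj_surjective (proj x)
  have hper : (fun y => per f (y + (z - x))) = per f := by
    funext y
    have h0 : proj (z - x) = 0 := by
      have := proj_add (z - x) x
      rw [sub_add_cancel, hzx] at this
      simpa using this
    simp [per, proj_add, h0]
  have h1 := fderiv_comp_add_right (𝕜 := ℝ) (f := per f) (x := x) (z - x)
  rw [hper] at h1
  show fderiv ℝ (per f) z _ = _
  rw [h1, add_sub_cancel]

/-- `∂_{x_k} : C^{r+1} → C^r`. -/
def partialDeriv (k : Fin d) (f : Cr d (r + 1)) : Cr d r := ⟨partialFun k f, by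
  show ContDiff ℝ r (per (partialFun k f))
  rw [funext (per_partialFun k f)]
  have h : ContDiff ℝ r (fderiv ℝ (per f)) := f.contDiff.fderiv_right (by norm_cast)
  exact h.clm_apply contDiff_const⟩

end Cr

/-- The norm of `C^q(𝕋^d, ℝ)` for a real `q ≥ 0`: the sum of the sup norms of the derivatives of
order at most `⌊q⌋` and, if `q` is not an integer, the Hölder seminorm of exponent `q - ⌊q⌋` of
the derivative of order `⌊q⌋`. -/
def cqNorm (q : ℝ) (f : Torus d → ℝ) : ENNReal :=
  (∑ j ∈ Finset.range (⌊q⌋₊ + 1), ⨆ x : Euc d, ‖iteratedFDeriv ℝ j (per f) x‖ₑ) +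
    if q = ⌊q⌋₊ then 0
    else eHolderNorm (Real.toNNReal (q - ⌊q⌋₊)) (iteratedFDeriv ℝ ⌊q⌋₊ (per f))

/-- Membership in `C^q(𝕋^d, ℝ)` for a real `q ≥ 0`. -/
def MemCq (q : ℝ) (f : Torus d → ℝ) : Prop :=
  ContDiff ℝ ⌊q⌋₊ (per f) ∧ cqNorm q f ≠ ⊤

/-! ### The coupled maps -/

/-- The data `T ∈ C^∞(𝕋^d, 𝕋^d)`, `α ∈ C^∞(𝕋^d, ℝ)` and `β ∈ C^∞(𝕋^d, ℝ^d)`, the latter given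
by its components. -/
structure Model (d : ℕ) where
  T : TorusMap d ∞
  α : CFun d ∞
  β : Fin d → CFun d ∞

/-- The map `x ↦ T(x) + ν s β(x) mod 1`; for `s = h(α)` this is `T_{ν,h}`. -/
def Model.coupledMap (M : Model d) (r : ℕ) (ν s : ℝ) : TorusMap d r where
  toFun x := M.T.toFun x + proj (WithLp.toLp 2 fun k => ν * s * (M.β k).1 x)
  exists_lift := by
    obtain ⟨F, hF, e⟩ := M.T.exists_lift
    have hr : ((r : ℕ) : WithTop ℕ∞) ≤ ∞ := by exact_mod_cast le_top
    refine ⟨fun x => F x + WithLp.toLp 2 fun k => ν * s * (M.β k).1 (proj x), ?_, fun x => ?_⟩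
    · refine (hF.of_le hr).add ?_
      rw [contDiff_euclidean]
      intro k
      exact contDiff_const.mul (ContDiff.of_le (n := ∞) (M.β k).2 hr)
    · rw [proj_add, e]

/-- The set `𝒯` consists of surjective maps, is closed under composition, and contains `T_{ν,μ}`
for all `ν ∈ [0, ν_*]` and all probability measures `μ`. -/
structure Model.Admissible (M : Model d) (𝒯 : Set (TorusMap d r)) (νstar : ℝ) : Prop where
  surjective : ∀ S ∈ 𝒯, Function.Surjective S.toFun
  comp_mem : ∀ S₁ ∈ 𝒯, ∀ S₂ ∈ 𝒯, S₁.comp S₂ ∈ 𝒯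
  coupled_mem : ∀ ν ∈ Icc 0 νstar, ∀ μ : Measure (Torus d), IsProbabilityMeasure μ →
    M.coupledMap r ν (∫ x, M.α.1 x ∂μ) ∈ 𝒯

/-! ### Scales of Banach spaces of distributions -/

section Scale

variable {B : Fin 4 → Type*} [∀ i, NormedAddCommGroup (B i)] [∀ i, NormedSpace ℝ (B i)]

variable (d r B) in
/-- Spaces `(C^r)' ⊃ B₀ ⊃ B₁ ⊃ B₂ ⊃ B₃ ⊃ C^r`, with `‖·‖_{B_i} ≤ ‖·‖_{B_{i+1}}` and `C^r` dense
in each `B_i` and in each dual `B_i'`. The spaces are embedded in `(C^r)'` by `emb`, and `C^r` is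
embedded in `(C^r)'` by `f ↦ (φ ↦ ∫ f φ dm)`. -/
structure Scale where
  emb : (i : Fin 4) → B i →L[ℝ] (Cr d r →L[ℝ] ℝ)
  emb_injective : ∀ i, Function.Injective (emb i)
  nested : ∀ i j : Fin 4, (j : ℕ) + 1 = i → ∃ J : B i →L[ℝ] B j,
    (∀ h, emb j (J h) = emb i h) ∧ ∀ h, ‖J h‖ ≤ ‖h‖
  contains_Cr : ∀ f : Cr d r, ∃ h : B 3, ∀ φ, emb 3 h φ = ∫ x, f x * φ x
  dense_Cr : ∀ i, Dense {h : B i | ∃ f : Cr d r, ∀ φ, emb i h φ = ∫ x, f x * φ x}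
  dense_Cr_dual : ∀ i, DenseRange fun φ : Cr d r => (emb i).flip φ

namespace Scale

variable (X : Scale d r B)

/-- The integral `∫ h = h(1)`. -/
def int (i : Fin 4) (h : B i) : ℝ := X.emb i h Cr.one

/-- Nonnegativity of a distribution. -/
def Nonneg (i : Fin 4) (h : B i) : Prop :=
  ∀ φ : Cr d r, (∀ x, 0 ≤ φ x) → 0 ≤ X.emb i h φ

/-- The distributions of zero integral in `B_i`; for `i = 1` this is the space `𝕍`, and for
`i = 2, 3` it is `𝕍 ∩ B_i`. -/
def zeroMean (i : Fin 4) : Submodule ℝ (B i) :=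
  LinearMap.ker ((X.emb i).flip Cr.one : B i →L[ℝ] ℝ).toLinearMap

/-- `J` is the inclusion of `B_i` in `B_j`. -/
def IsIncl (i j : Fin 4) (J : B i →L[ℝ] B j) : Prop := ∀ h, X.emb j (J h) = X.emb i h

/-- `A` is the transfer operator of `S` on `B_i`: `∫ g · A h = ∫ g ∘ S · h`. -/
def IsTransfer (i : Fin 4) (S : TorusMap d r) (A : B i →L[ℝ] B i) : Prop :=
  ∀ h g, X.emb i (A h) g = X.emb i h (g.comp S)

/-- `D` is the distributional derivative `∂_{x_k}`, as an operator from `B_i` to `B_j`. -/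
def IsPartial (i j : Fin 4) (k : Fin d) (D : B i →L[ℝ] B j) : Prop :=
  ∀ (h : B i) (φ : Cr d (r + 1)), X.emb j (D h) φ.ofSucc = -X.emb i h (φ.partialDeriv k)

/-- `P` is the multiplication by `a` on `B_i`. -/
def IsMul (i : Fin 4) (a : Cr d r) (P : B i →L[ℝ] B i) : Prop :=
  ∀ h φ, X.emb i (P h) φ = X.emb i h (a.mul φ)

/-! Each of the following operators is unique if it exists, since `emb` is injective and `C^{r+1}`
is dense in `C^r`. -/

/-- The inclusion of `B_i` in `B_j`. -/
def incl (i j : Fin 4) : B i →L[ℝ] B j := Classical.epsilon (X.IsIncl i j)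

/-- The transfer operator `ℒ_S` on `B_i`. -/
def transfer (i : Fin 4) (S : TorusMap d r) : B i →L[ℝ] B i :=
  Classical.epsilon (X.IsTransfer i S)

/-- The operator `∂_{x_k}` from `B_i` to `B_j`. -/
def partialOp (i j : Fin 4) (k : Fin d) : B i →L[ℝ] B j := Classical.epsilon (X.IsPartial i j k)

/-- The multiplication by `a` on `B_i`. -/
def mulOp (i : Fin 4) (a : Cr d r) : B i →L[ℝ] B i := Classical.epsilon (X.IsMul i a)

/-- `ℒ_{S_n} ⋯ ℒ_{S_1}` on `B_i`, for the list `[S_1, …, S_n]`. -/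
def transferList (i : Fin 4) (l : List (TorusMap d r)) : B i →L[ℝ] B i :=
  l.foldl (fun A S => (X.transfer i S).comp A) (ContinuousLinearMap.id ℝ (B i))

/-- The standing assumptions on the action of the maps of `𝒯` on the scale. -/
structure Assumptions (𝒯 : Set (TorusMap d r)) (K C c₁ c₂ ϑ : ℝ) : Prop where
  one_le_K : 1 ≤ K
  one_le_C : 1 ≤ C
  c₁_pos : 0 < c₁
  c₂_pos : 0 < c₂
  ϑ_mem : ϑ ∈ Ioo (0 : ℝ) 1
  transfer_bounded : ∀ S ∈ 𝒯, ∀ i, ∃ A, X.IsTransfer i S A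
  partial_bounded : ∀ (k : Fin d) (i j : Fin 4), (j : ℕ) + 1 = i → ∃ D, X.IsPartial i j k D
  mul_bounded : ∀ (i : Fin 4) (a : Cr d r), MemCq (c₁ * (i : ℕ) + c₂) a →
    ∃ P, X.IsMul i a P ∧ ∀ h, ‖P h‖ ≤ C * (cqNorm (c₁ * (i : ℕ) + c₂) a).toReal * ‖h‖
  int_bounded : ∀ h : B 0, |X.int 0 h| ≤ C * ‖h‖
  compact : ∀ i j : Fin 4, (j : ℕ) + 1 = i →
    IsCompact (closure (X.incl i j '' Metric.closedBall 0 1))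
  weak_bound : ∀ l : List (TorusMap d r), (∀ S ∈ l, S ∈ 𝒯) → ∀ φ : B 0,
    ‖X.transferList 0 l φ‖ ≤ C * ‖φ‖
  lasota_yorke : ∀ l : List (TorusMap d r), (∀ S ∈ l, S ∈ 𝒯) →
    ∀ i j : Fin 4, (j : ℕ) + 1 = i → ∀ φ : B i,
      ‖X.transferList i l φ‖ ≤ C * ϑ ^ l.length * ‖φ‖ + K * ‖X.incl i j φ‖
  contraction : ∃ N : ℕ, ∀ l : List (TorusMap d r), (∀ S ∈ l, S ∈ 𝒯) → N ≤ l.length →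
    ∀ i : Fin 4, 1 ≤ (i : ℕ) →
      ‖(X.transferList i l).comp (X.zeroMean i).subtypeL‖ < ϑ ^ l.length

/-- The set `𝕎` of the probability measures in `B₁` of norm at most `Kstar`. -/
def W (Kstar : ℝ) : Set (B 1) := {h | ‖h‖ ≤ Kstar ∧ X.Nonneg 1 h ∧ X.int 1 h = 1}

variable (M : Model d)

/-- `∫ α h`. -/
def intα (h : B 1) : ℝ := X.emb 1 h (Cr.ofSmooth M.α)

/-- The map `T_{ν,h}` for `h ∈ B₁`. -/
def map (ν : ℝ) (h : B 1) : TorusMap d r := M.coupledMap r ν (X.intα M h)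

/-- `h` is a fixed point of the nonlinear transfer operator `h ↦ ℒ_{T_{ν,h}} h`, that is
`∫ g ∘ T_{ν,h} · h = ∫ g · h` for all `g`. -/
def IsFixed (ν : ℝ) (h : B 1) : Prop :=
  ∀ g : Cr d r, X.emb 1 h (g.comp (X.map M ν h)) = X.emb 1 h g

/-- The invariant probability measure `H(ν,h)` of `T_{ν,h}` in the scale; the assumptions make it
exist, be unique and belong to `B₃`. -/
def H (ν : ℝ) (h : B 1) : B 3 := Classical.epsilon fun η =>
  X.Nonneg 3 η ∧ X.int 3 η = 1 ∧ X.transfer 3 (X.map M ν h) η = η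

/-- `div ℒ_{T_{ν,h}} (β H(ν,h)) = ∑_k ∂_{x_k} ℒ_{T_{ν,h}} (β_k H(ν,h))`. -/
def divTransfer (ν : ℝ) (h : B 1) : B 2 :=
  ∑ k, X.partialOp 3 2 k
    (X.transfer 3 (X.map M ν h) (X.mulOp 3 (Cr.ofSmooth (M.β k)) (X.H M ν h)))

/-- `Θ(ν,h) = -(Id - ℒ_{T_{ν,h}})⁻¹ div ℒ_{T_{ν,h}} (β H(ν,h))`, where the inverse is that of the
restriction of `Id - ℒ_{T_{ν,h}}` to the space `𝕍`. -/
def Theta (ν : ℝ) (h : B 1) : B 1 := Classical.epsilon fun θ =>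
  θ ∈ X.zeroMean 1 ∧ θ - X.transfer 1 (X.map M ν h) θ = -X.incl 2 1 (X.divTransfer M ν h)

end Scale

end Scale

end MeanFieldMaps

end

noncomputable section

namespace MeanFieldMaps

variable {d r : ℕ}

/-! The map `T_{ν,h}` depends on `(ν, h)` only through the number `t = ν ∫ α h`
(`coupledMap_eq_shift`). Let `m(t)` be the invariant probability measure of `T + t β`, and put `a(t)
= ∫ α m(t)`. A fixed point of the nonlinear operator is then the same as `h = m(t)` with `t = ν
a(t)`, so the infinite-dimensional problem becomes one scalar equation.

Linear response makes `m` of class `C^1` into `B₁` (`linear_response`,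
`contDiff_of_quadratic_estimate`). Its derivative is the solution of `(Id - ℒ_t) θ = ℒ_t' m(t)`, and
this is `Θ` (`Theta_eq`). Two facts carry the proof. On zero-mean distributions `Id - ℒ_t` has a
uniformly bounded inverse (`resolvent`). In `t`, the operator `ℒ_t` is Lipschitz with loss of one
level of the scale and has a first-order Taylor expansion with loss of two (`lipschitz_transfer`,
`taylor_transfer`). That is why the measure is taken in `B₃` and the derivative in `B₁`.

The nondegeneracy condition reads `ν a'(t) ≠ 1`. For `t ≠ 0` the equation is solved for `ν` instead
of `t`: `ν = N(t) = t / a(t)`, with `N' = (a - t a') / a²`, which is nonzero exactly when `ν a'(t) ≠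
1`. The branch is the inverse of `N` on the largest interval around `t₀` where `N'` does not vanish
and `ν` stays below `ν_*` (`hasMaximalBranch_of_pos`; the case `t₀ < 0` follows by reflection). For
`t₀ = 0` the branch is constant (`hasMaximalBranch_zero`). What stops the interval gives the
alternatives at its ends (`exists_maximal_branch`). -/

lemma proj_sub (x y : Euc d) : proj (x - y) = proj x - proj y := by
  funext i; simp [proj]

lemma continuous_proj : Continuous (proj : Euc d → Torus d) :=
  continuous_pi fun i => (AddCircle.continuous_mk' 1).comp (EuclideanSpace.proj i).continuous

lemma isOpenQuotientMap_proj : IsOpenQuotientMap (proj : Euc d → Torus d) :=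
  (IsOpenQuotientMap.piMap fun _ : Fin d => QuotientAddGroup.isOpenQuotientMap_mk
    (N := AddSubgroup.zmultiples (1 : ℝ))).comp
    (EuclideanSpace.equiv (Fin d) ℝ).toHomeomorph.isOpenQuotientMap

instance : ConnectedSpace (Torus d) :=
  proj_surjective.connectedSpace continuous_proj

lemma continuous_of_continuous_per {f : Torus d → ℝ} (hf : Continuous (per f)) : Continuous f :=
  isOpenQuotientMap_proj.isQuotientMap.continuous_iff.2 hf

lemma CFun.continuous {n : WithTop ℕ∞} (f : CFun d n) : Continuous f.1 :=
  continuous_of_continuous_per (ContDiff.continuous (n := n) f.2)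

namespace Cr

@[ext] lemma ext {f g : Cr d r} (h : ∀ x, f x = g x) : f = g := Subtype.ext (funext h)

lemma continuous (f : Cr d r) : Continuous (f : Torus d → ℝ) := CFun.continuous f

lemma norm_le {f : Cr d r} {c : ℝ} (hc : 0 ≤ c)
    (h : ∀ j ≤ r, ∀ x, ‖iteratedFDeriv ℝ j (per f) x‖ ≤ c) : ‖f‖ ≤ c := by
  show ‖(jet f : JetSpace d r)‖ ≤ c
  refine (pi_norm_le_iff_of_nonneg (G := fun j : Fin (r + 1) =>
    Euc d →ᵇ (Euc d [×(j : ℕ)]→L[ℝ] ℝ)) hc).2 fun j => ?_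
  exact (BoundedContinuousFunction.norm_le hc).2 fun x => h j (Nat.lt_succ_iff.1 j.2) x

end Cr

/-! ### Mollification and density of `C^{r+1}` in `C^r` -/

section Mollification

open scoped Convolution

/-- The derivative is put on `g`, so that `ρ` need only be continuous. For `z` in the unit ball
about `x`, only values of `fderiv ℝ g` on the ball of radius `R + 1` about `x` enter, which gives
the dominating function. -/
lemma hasFDerivAt_convolution_of_contDiff {F : Type*} [NormedAddCommGroup F] [NormedSpace ℝ F]
    [CompleteSpace F] {ρ : Euc d → ℝ} (hρ : Continuous ρ) (hρc : HasCompactSupport ρ)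
    {g : Euc d → F} (hg : ContDiff ℝ 1 g) (x : Euc d) :
    HasFDerivAt (ρ ⋆[ContinuousLinearMap.lsmul ℝ ℝ, volume] g)
      ((ρ ⋆[ContinuousLinearMap.lsmul ℝ ℝ, volume] fderiv ℝ g) x) x := by
  have hg' : Continuous (fderiv ℝ g) := hg.continuous_fderiv one_ne_zero
  obtain ⟨R, hR⟩ := hρc.isBounded.exists_norm_le
  obtain ⟨c, hc⟩ := (isCompact_closedBall x (R + 1)).exists_bound_of_continuousOn
    hg'.continuousOn
  have hint : ∀ z, Integrable (fun t => ρ t • g (z - t)) := fun z =>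
    Continuous.integrable_of_hasCompactSupport
      (hρ.smul (hg.continuous.comp (continuous_const.sub continuous_id))) hρc.smul_right
  refine hasFDerivAt_integral_of_dominated_of_fderiv_le (F := fun z t => ρ t • g (z - t))
    (F' := fun z t => ρ t • fderiv ℝ g (z - t)) (bound := fun t => ‖ρ t‖ * c)
    (Metric.ball_mem_nhds x one_pos)
    (Filter.Eventually.of_forall fun z => (hint z).aestronglyMeasurable) (hint x) ?_ ?_ ?_ ?_
  · exact (hρ.smul (hg'.comp (continuous_const.sub continuous_id))).aestronglyMeasurable
  · refine Filter.Eventually.of_forall fun t z hz => ?_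
    rw [norm_smul]
    by_cases ht : ρ t = 0
    · simp [ht]
    · refine mul_le_mul_of_nonneg_left (hc _ ?_) (norm_nonneg _)
      have h1 := hR t (subset_tsupport _ ht)
      rw [mem_closedBall_iff_norm]
      rw [mem_ball_iff_norm] at hz
      calc ‖z - t - x‖ = ‖(z - x) - t‖ := by congr 1; abel
        _ ≤ ‖z - x‖ + ‖t‖ := norm_sub_le _ _
        _ ≤ R + 1 := by linarith
  · exact (hρ.norm.integrable_of_hasCompactSupport hρc.norm).mul_const c
  · refine Filter.Eventually.of_forall fun t z _ => ?_
    have h1 : HasFDerivAt g (fderiv ℝ g (z - t)) (z - t) :=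
      (hg.differentiable one_ne_zero _).hasFDerivAt
    exact (h1.comp z ((hasFDerivAt_id z).sub_const t)).const_smul (ρ t)

/-- Since all derivatives fall on `f`, mollifying `f` mollifies its whole jet; `C^r` convergence
then only needs uniform continuity of the derivatives up to order `r`, including the top one. -/
lemma iteratedFDeriv_convolution {ρ : Euc d → ℝ} (hρ : Continuous ρ) (hρc : HasCompactSupport ρ)
    {f : Euc d → ℝ} (hf : ContDiff ℝ r f) (j : ℕ) (hj : j ≤ r) :
    iteratedFDeriv ℝ j (ρ ⋆[ContinuousLinearMap.lsmul ℝ ℝ, volume] f) =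
      ρ ⋆[ContinuousLinearMap.lsmul ℝ ℝ, volume] iteratedFDeriv ℝ j f := by
  induction j with
  | zero =>
    funext x
    rw [iteratedFDeriv_zero_eq_comp, iteratedFDeriv_zero_eq_comp]
    simp only [Function.comp_apply, convolution_def, ContinuousLinearMap.lsmul_apply]
    refine ((continuousMultilinearCurryFin0 ℝ (Euc d) ℝ).symm.toContinuousLinearEquiv.integral_comp_comm
      _).symm.trans (integral_congr_ae (Filter.Eventually.of_forall fun t => ?_))
    exact map_smul (continuousMultilinearCurryFin0 ℝ (Euc d) ℝ).symm (ρ t) (f (x - t))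
  | succ j ih =>
    funext x
    have hg : ContDiff ℝ 1 (iteratedFDeriv ℝ j f) :=
      hf.iteratedFDeriv_right (by exact_mod_cast (by omega : 1 + j ≤ r))
    rw [iteratedFDeriv_succ_eq_comp_left, iteratedFDeriv_succ_eq_comp_left, ih (by omega)]
    simp only [Function.comp_apply]
    rw [(hasFDerivAt_convolution_of_contDiff hρ hρc hg x).fderiv]
    simp only [convolution_def, ContinuousLinearMap.lsmul_apply]
    let e : (Euc d →L[ℝ] (Euc d [×j]→L[ℝ] ℝ)) ≃ₗᵢ[ℝ] (Euc d [×(j + 1)]→L[ℝ] ℝ) :=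
      (continuousMultilinearCurryLeftEquiv ℝ (fun _ : Fin (j + 1) => Euc d) ℝ).symm
    refine (ContinuousLinearEquiv.integral_comp_comm (X := Euc d) (μ := volume) (𝕜 := ℝ)
      (E := Euc d →L[ℝ] (Euc d [×j]→L[ℝ] ℝ)) (F := Euc d [×(j + 1)]→L[ℝ] ℝ) e.toContinuousLinearEquiv _).symm.trans
      (integral_congr_ae (Filter.Eventually.of_forall fun t => ?_))
    exact map_smul e (ρ t) (fderiv ℝ (iteratedFDeriv ℝ j f) (x - t))

end Mollification

lemma iteratedFDeriv_per_eq (f : Torus d → ℝ) (j : ℕ) {x z : Euc d} (h : proj x = proj z) :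
    iteratedFDeriv ℝ j (per f) x = iteratedFDeriv ℝ j (per f) z := by
  have h0 : proj (z - x) = 0 := by rw [proj_sub, h, sub_self]
  have hper : (fun y => per f (y + (z - x))) = per f := by
    funext y; simp [per, proj_add, h0]
  have h1 := iteratedFDeriv_comp_add_right (𝕜 := ℝ) (f := per f) j (z - x) x
  rw [hper] at h1
  rw [h1, add_sub_cancel]

lemma uniformContinuous_proj : UniformContinuous (proj : Euc d → Torus d) :=
  uniformContinuous_addMonoidHom_of_continuous
    (f := ({ toFun := proj, map_zero' := by funext i; simp [proj], map_add' := proj_add } :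
      Euc d →+ Torus d)) continuous_proj

lemma Cr.uniformContinuous_iteratedFDeriv (f : Cr d r) {j : ℕ} (hj : j ≤ r) :
    UniformContinuous (iteratedFDeriv ℝ j (per f)) := by
  set G : Torus d → (Euc d [×j]→L[ℝ] ℝ) := fun y =>
    iteratedFDeriv ℝ j (per f) (Function.surjInv proj_surjective y) with hG
  have hGp : G ∘ proj = iteratedFDeriv ℝ j (per f) := funext fun x =>
    iteratedFDeriv_per_eq f j (Function.surjInv_eq proj_surjective (proj x))
  have hc : Continuous (iteratedFDeriv ℝ j (per f)) :=
    f.contDiff.continuous_iteratedFDeriv (by exact_mod_cast hj)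
  have hGc : Continuous G :=
    isOpenQuotientMap_proj.isQuotientMap.continuous_iff.2 (hGp ▸ hc)
  rw [← hGp]
  exact (CompactSpace.uniformContinuous_of_continuous hGc).comp uniformContinuous_proj

open scoped Convolution in
/-- The functions of class `C^{r+1}` are dense in `C^r`. -/
lemma Cr.denseRange_ofSucc : DenseRange (Cr.ofSucc : Cr d (r + 1) → Cr d r) := by
  refine Metric.dense_iff.2 fun f ε hε => ?_
  have h1 : ∀ j : Fin (r + 1), ∃ δ > 0, ∀ x y : Euc d, dist x y < δ →
      dist (iteratedFDeriv ℝ j (per f) x) (iteratedFDeriv ℝ j (per f) y) < ε / 2 := fun j =>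
    let ⟨δ, hδ, h⟩ := Metric.uniformContinuous_iff.1
      (f.uniformContinuous_iteratedFDeriv (Nat.lt_succ_iff.1 j.2)) (ε / 2) (half_pos hε)
    ⟨δ, hδ, fun x y hxy => h hxy⟩
  choose δ hδ h using h1
  set δ₀ := Finset.univ.inf' Finset.univ_nonempty δ with hδ₀
  have hδ₀p : 0 < δ₀ := (Finset.lt_inf'_iff _).2 fun j _ => hδ j
  let φ : ContDiffBump (0 : Euc d) := ⟨δ₀ / 2, δ₀, half_pos hδ₀p, half_lt_self hδ₀p⟩
  set ρ : Euc d → ℝ := φ.normed volume with hρ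
  have hρs : ContDiff ℝ ∞ ρ := φ.contDiff_normed
  have hρc : HasCompactSupport ρ := φ.hasCompactSupport_normed
  -- The mollified function is defined on the torus itself, so periodicity is built in.
  have hper : per (fun y : Torus d => ∫ t, ρ t * f (y - proj t)) =
      ρ ⋆[ContinuousLinearMap.lsmul ℝ ℝ, volume] per f := by
    funext x
    simp [per, convolution_def, proj_sub]
  let g : Cr d (r + 1) := ⟨fun y => ∫ t, ρ t * f (y - proj t), by
    show ContDiff ℝ ((r + 1 : ℕ) : WithTop ℕ∞) (per _)
    rw [hper]
    exact hρc.contDiff_convolution_left (n := ((r + 1 : ℕ) : ℕ∞)) _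
      (hρs.of_le (by exact_mod_cast le_top)) f.contDiff.continuous.locallyIntegrable⟩
  refine ⟨g.ofSucc, ?_, mem_range_self g⟩
  rw [mem_ball_iff_norm]
  refine (Cr.norm_le (half_pos hε).le fun j hj x => ?_).trans_lt (half_lt_self hε)
  have hjr : ((j : ℕ) : WithTop ℕ∞) ≤ r := by exact_mod_cast hj
  have hsub : per (g.ofSucc - f : Cr d r) = per (g.ofSucc) - per f := rfl
  have hgs : per (g.ofSucc) = ρ ⋆[ContinuousLinearMap.lsmul ℝ ℝ, volume] per f := hper
  rw [hsub, iteratedFDeriv_sub_apply (g.ofSucc.contDiff.of_le hjr).contDiffAt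
    (f.contDiff.of_le hjr).contDiffAt, hgs,
    iteratedFDeriv_convolution hρs.continuous hρc f.contDiff j hj, ← dist_eq_norm]
  refine φ.dist_normed_convolution_le
    (f.contDiff.continuous_iteratedFDeriv hjr).aestronglyMeasurable fun y hy => ?_
  exact (h ⟨j, Nat.lt_succ_iff.2 hj⟩ y x
    ((Metric.mem_ball.1 hy).trans_le (Finset.inf'_le _ (Finset.mem_univ _)))).le

/-- A smooth function is of class `C^q` for every `q ≥ 0`. -/
lemma CFun.memCq (f : CFun d ∞) {q : ℝ} (hq : 0 ≤ q) : MemCq q f.1 := by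
  have hf : ∀ j : ℕ, ContDiff ℝ j (per f.1) := fun j => (Cr.ofSmooth (r := j) f).contDiff
  have hb : ∀ j : ℕ, ∃ c : ℝ, ∀ x, ‖iteratedFDeriv ℝ j (per f.1) x‖ ≤ c := fun j =>
    (Cr.ofSmooth (r := j) f).exists_bound j le_rfl
  refine ⟨hf _, ENNReal.add_ne_top.2 ⟨?_, ?_⟩⟩
  · refine ENNReal.sum_ne_top.2 fun j _ => ?_
    obtain ⟨c, hc⟩ := hb j
    refine ne_top_of_le_ne_top (ENNReal.ofReal_ne_top (r := c)) (iSup_le fun x => ?_)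
    rw [← ofReal_norm]
    exact ENNReal.ofReal_le_ofReal (hc x)
  · split_ifs
    · simp
    rw [eHolderNorm_ne_top]
    set j := ⌊q⌋₊
    set s : ℝ := q - j
    have hs0 : 0 ≤ s := sub_nonneg.2 (Nat.floor_le hq)
    have hs1 : s ≤ 1 := by linarith [Nat.lt_floor_add_one q]
    obtain ⟨c, hc⟩ := hb j
    obtain ⟨L, hL⟩ := hb (j + 1)
    have hc0 : 0 ≤ c := (norm_nonneg _).trans (hc 0)
    have hL0 : 0 ≤ L := (norm_nonneg _).trans (hL 0)
    refine ⟨Real.toNNReal (L + 2 * c), fun x y => ?_⟩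
    have hlip : ‖iteratedFDeriv ℝ j (per f.1) x - iteratedFDeriv ℝ j (per f.1) y‖ ≤ L * ‖x - y‖ := by
      refine Convex.norm_image_sub_le_of_norm_fderiv_le (𝕜 := ℝ) (s := univ) (fun z _ => ?_)
        (fun z _ => ?_) convex_univ (mem_univ y) (mem_univ x)
      · exact (hf (j + 1)).differentiable_iteratedFDeriv (by exact_mod_cast Nat.lt_succ_self j) z
      · rw [norm_fderiv_iteratedFDeriv]; exact hL z
    have key : dist (iteratedFDeriv ℝ j (per f.1) x) (iteratedFDeriv ℝ j (per f.1) y) ≤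
        (L + 2 * c) * dist x y ^ s := by
      rw [dist_eq_norm, dist_eq_norm]
      -- At distance at most `1` the Lipschitz bound suffices because `s ≤ 1`; beyond that the sup
      -- bound does.
      rcases le_total ‖x - y‖ 1 with h | h
      · have h2 : ‖x - y‖ ≤ ‖x - y‖ ^ s := by
          rcases (norm_nonneg (x - y)).eq_or_lt with h0 | h0
          · rw [← h0]; positivity
          · simpa using Real.rpow_le_rpow_of_exponent_ge h0 h hs1
        calc _ ≤ L * ‖x - y‖ := hlip
          _ ≤ L * ‖x - y‖ ^ s := by gcongr
          _ ≤ _ := by gcongr; linarith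
      · have h2 : 1 ≤ ‖x - y‖ ^ s := Real.one_le_rpow h hs0
        calc _ ≤ c + c := (norm_sub_le _ _).trans (add_le_add (hc x) (hc y))
          _ ≤ (L + 2 * c) * 1 := by linarith
          _ ≤ _ := by gcongr
    rw [edist_dist, edist_dist, Real.coe_toNNReal _ hs0, ENNReal.ofReal_rpow_of_nonneg dist_nonneg hs0,
      show ((Real.toNNReal (L + 2 * c) : NNReal) : ENNReal) = ENNReal.ofReal (L + 2 * c) from rfl,
      ← ENNReal.ofReal_mul (by positivity)]
    exact ENNReal.ofReal_le_ofReal key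

/-! ### The one-parameter family `T + t β` -/

namespace Model

variable (M : Model d)

/-- The map `x ↦ T(x) + t β(x) mod 1`. -/
def shift (r : ℕ) (t : ℝ) : TorusMap d r := M.coupledMap r t 1

/-- This is the reduction to one real parameter. -/
lemma coupledMap_eq_shift (r : ℕ) (ν s : ℝ) : M.coupledMap r ν s = M.shift r (ν * s) := by
  ext x : 2
  simp [shift, coupledMap]

/-- The parameters `t = ν ∫ α dμ` of the maps `T_{ν,μ}`, for `ν ∈ [0, ν_*]` and `μ` a point
mass. -/
def params (νstar : ℝ) : Set ℝ :=
  (fun p : ℝ × Torus d => p.1 * M.α.1 p.2) '' (Icc 0 νstar ×ˢ univ)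

variable {M} {νstar : ℝ}

/-- Continuous image of a compact connected set. Convexity in `t` is needed for the mean value
estimates, compactness for the bound `K₀`. -/
lemma params_eq_Icc (hν : 0 ≤ νstar) : ∃ a b, a ≤ b ∧ M.params νstar = Icc a b := by
  have hc : Continuous fun p : ℝ × Torus d => p.1 * M.α.1 p.2 :=
    continuous_fst.mul ((CFun.continuous M.α).comp continuous_snd)
  have hconn : IsConnected (M.params νstar) :=
    ((isConnected_Icc hν).prod isConnected_univ).image _ hc.continuousOn
  have heq := eq_Icc_of_connected_compact hconn ((isCompact_Icc.prod isCompact_univ).image hc)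
  refine ⟨_, _, ?_, heq⟩
  by_contra h
  rw [Icc_eq_empty h] at heq
  exact hconn.nonempty.ne_empty heq

lemma zero_mem_params (hν : 0 ≤ νstar) : (0 : ℝ) ∈ M.params νstar :=
  ⟨(0, 0), ⟨⟨le_rfl, hν⟩, mem_univ _⟩, by simp⟩

/-- A number between two values of `α` is a value of `α`, so its multiples are parameters. -/
lemma mul_mem_params {ν s : ℝ} (hν : ν ∈ Icc 0 νstar) {x y : Torus d} (hx : M.α.1 x ≤ s)
    (hy : s ≤ M.α.1 y) : ν * s ∈ M.params νstar := by
  obtain ⟨z, hz⟩ := mem_range_of_exists_le_of_exists_ge (CFun.continuous M.α) ⟨x, hx⟩ ⟨y, hy⟩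
  exact ⟨(ν, z), ⟨hν, mem_univ _⟩, by simp [hz]⟩

lemma Admissible.shift_mem {𝒯 : Set (TorusMap d r)} (h : M.Admissible 𝒯 νstar) {t : ℝ}
    (ht : t ∈ M.params νstar) : M.shift r t ∈ 𝒯 := by
  obtain ⟨⟨ν, x⟩, ⟨hν, -⟩, rfl⟩ := ht
  have := h.coupled_mem ν hν (Measure.dirac x) inferInstance
  rwa [integral_dirac, coupledMap_eq_shift] at this

end Model

/-- In the lift, `t` moves the image point along a straight line of direction `β`, so this is the
chain rule. The test function is of class `C^{r+1}` so that its partial derivatives can again be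
tested against. -/
lemma hasDerivAt_comp_shift (M : Model d) (φ : Cr d (r + 1)) (x : Torus d) (t : ℝ) :
    HasDerivAt (fun t => φ.ofSucc.comp (M.shift r t) x)
      (∑ k, (M.β k).1 x * (φ.partialDeriv k).comp (M.shift r t) x) t := by
  obtain ⟨y, rfl⟩ := proj_surjective x
  obtain ⟨F, hF, e⟩ := M.T.exists_lift
  let b : Euc d := WithLp.toLp 2 fun k => (M.β k).1 (proj y)
  have hshift : ∀ t, (M.shift r t).toFun (proj y) = proj (F y + t • b) := fun t => by
    rw [proj_add, e]
    simp only [Model.shift, Model.coupledMap, b, mul_one]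
    rfl
  have h1 : (fun t => φ.ofSucc.comp (M.shift r t) (proj y)) = fun t => per φ (F y + t • b) :=
    funext fun t => congrArg φ.1 (hshift t)
  have hb : b = ∑ k, (M.β k).1 (proj y) • EuclideanSpace.single k (1 : ℝ) := by
    ext i; simp [b, Pi.single_apply]
  have hd : HasFDerivAt (per φ) (fderiv ℝ (per φ) (F y + t • b)) (F y + t • b) :=
    (φ.contDiff.differentiable (by simp) _).hasFDerivAt
  have hl : HasDerivAt (fun t : ℝ => F y + t • b) b t := by
    simpa using ((hasDerivAt_id t).smul_const b).const_add (F y)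
  rw [h1]
  refine (hd.comp_hasDerivAt t hl).congr_deriv ?_
  have h2 : ∀ A : Euc d →L[ℝ] ℝ,
      A b = ∑ k, (M.β k).1 (proj y) * A (EuclideanSpace.single k 1) := fun A => by
    rw [hb, map_sum]; simp only [map_smul, smul_eq_mul]
  rw [h2]
  refine Finset.sum_congr rfl fun k _ => ?_
  rw [← Cr.per_partialFun]
  exact (congrArg (fun z => (M.β k).1 (proj y) * Cr.partialFun k φ z) (hshift t)).symm

lemma hasDerivAt_integral_comp_shift (M : Model d) (f : Cr d r) (φ : Cr d (r + 1)) (t : ℝ) :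
    HasDerivAt (fun t => ∫ x, f x * φ.ofSucc.comp (M.shift r t) x)
      (∑ k, ∫ x, f x * ((Cr.ofSmooth (M.β k)).mul ((φ.partialDeriv k).comp (M.shift r t))) x)
      t := by
  have hbd : ∀ g : Torus d → ℝ, Continuous g → ∃ c, ∀ x, ‖g x‖ ≤ c := fun g hg =>
    let ⟨c, hc⟩ := isCompact_univ.exists_bound_of_continuousOn hg.continuousOn
    ⟨c, fun x => hc x (mem_univ x)⟩
  obtain ⟨cf, hcf⟩ := hbd f f.continuous
  choose cβ hcβ using fun k => hbd (M.β k).1 (CFun.continuous (M.β k))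
  choose cφ hcφ using fun k => hbd (φ.partialDeriv k) (φ.partialDeriv k).continuous
  have hint : ∀ g : Cr d r, Integrable (fun x => f x * g x) := fun g =>
    Continuous.integrable_of_hasCompactSupport (f.continuous.mul g.continuous)
      (HasCompactSupport.of_compactSpace _)
  have hcf0 : 0 ≤ cf := (norm_nonneg _).trans (hcf 0)
  have hterm : ∀ t x k, f x * ((M.β k).1 x * (φ.partialDeriv k).comp (M.shift r t) x) =
    f x * ((Cr.ofSmooth (M.β k)).mul ((φ.partialDeriv k).comp (M.shift r t))) x := fun _ _ _ => rfl
  have key := (hasDerivAt_integral_of_dominated_loc_of_deriv_le (μ := volume)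
    (F := fun t x => f x * φ.ofSucc.comp (M.shift r t) x)
    (F' := fun t x => f x * ∑ k, (M.β k).1 x * (φ.partialDeriv k).comp (M.shift r t) x)
    (bound := fun _ => cf * ∑ k, cβ k * cφ k) (x₀ := t) Filter.univ_mem
    (Filter.Eventually.of_forall fun t => (hint _).aestronglyMeasurable) (hint _) ?_ ?_
    (integrable_const _) ?_).2
  · refine key.congr_deriv ?_
    rw [← integral_finsetSum _ fun k _ => hint _]
    simp_rw [Finset.mul_sum, hterm]
  · simp_rw [Finset.mul_sum, hterm]
    exact (integrable_finsetSum _ fun k _ => hint _).aestronglyMeasurable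
  · refine Filter.Eventually.of_forall fun x t _ => ?_
    rw [norm_mul]
    refine mul_le_mul (hcf x) ((norm_sum_le _ _).trans (Finset.sum_le_sum fun k _ => ?_))
      (norm_nonneg _) hcf0
    rw [norm_mul]
    exact mul_le_mul (hcβ k x) (hcφ k _) (norm_nonneg _) ((norm_nonneg _).trans (hcβ k x))
  · exact Filter.Eventually.of_forall fun x t _ => (hasDerivAt_comp_shift M φ x t).const_mul (f x)

/-! ### Inverting `Id - A` on an invariant subspace -/

/-- If a power of `A` contracts a closed invariant subspace `V`, then `1 - A` is invertible on `V`,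
with a bound on the inverse that depends only on the bounds on the powers of `A`. -/
lemma resolvent_on_invariant_subspace {E : Type*} [NormedAddCommGroup E] [NormedSpace ℝ E]
    [CompleteSpace E] (V : Submodule ℝ E) (hV : IsClosed (V : Set E)) (A : E →L[ℝ] E)
    (hA : ∀ v ∈ V, A v ∈ V) {c q : ℝ} (hq1 : q < 1) (N : ℕ) (hc : ∀ n v, ‖(A ^ n) v‖ ≤ c * ‖v‖)
    (hq : ∀ v ∈ V, ‖(A ^ N) v‖ ≤ q * ‖v‖) :
    (∀ v ∈ V, ‖v‖ ≤ N * c / (1 - q) * ‖v - A v‖) ∧ ∀ w ∈ V, ∃ v ∈ V, v - A v = w := by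
  have hgeom : ∀ v, v - (A ^ N) v = ∑ n ∈ Finset.range N, (A ^ n) (v - A v) := fun v => by
    have := congrArg (fun T : E →L[ℝ] E => T v) (geom_sum_mul_neg A N)
    simpa using this.symm
  refine ⟨fun v hv => ?_, fun w hw => ?_⟩
  · rw [div_mul_eq_mul_div, le_div_iff₀ (sub_pos.2 hq1)]
    have h1 : ‖v - (A ^ N) v‖ ≤ N * c * ‖v - A v‖ := by
      rw [hgeom]
      refine (norm_sum_le _ _).trans ((Finset.sum_le_sum fun n _ => hc n _).trans_eq ?_)
      simp [mul_assoc]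
    have h2 := norm_sub_norm_le v ((A ^ N) v)
    have h3 := hq v hv
    linarith
  · have : CompleteSpace V := hV.completeSpace_coe
    let T : V →L[ℝ] V := (A.comp V.subtypeL).codRestrict V fun v => hA v v.2
    have hT : ∀ n (v : V), ((T ^ n) v : E) = (A ^ n) v := by
      intro n
      induction n with
      | zero => intro v; rfl
      | succ n ih =>
        intro v
        rw [pow_succ, pow_succ]
        exact ih (T v)
    -- On the zero space `q` may be negative, so that case is set apart.
    rcases subsingleton_or_nontrivial V with hs | hn
    · refine ⟨0, V.zero_mem, ?_⟩
      have : (⟨w, hw⟩ : V) = 0 := Subsingleton.elim _ _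
      simpa using (congrArg Subtype.val this).symm
    have hq0 : 0 ≤ q := by
      obtain ⟨v, hv⟩ := exists_ne (0 : V)
      have h1 : 0 < ‖v‖ := norm_pos_iff.2 hv
      have h2 : 0 ≤ q * ‖v‖ := (norm_nonneg _).trans (hq v v.2)
      exact nonneg_of_mul_nonneg_left h2 h1
    have hTN : ‖T ^ N‖ < 1 := by
      refine (ContinuousLinearMap.opNorm_le_bound _ hq0 fun v => ?_).trans_lt hq1
      show ‖((T ^ N) v : E)‖ ≤ _
      rw [hT]
      exact hq v v.2
    obtain ⟨u, hu⟩ := isUnit_one_sub_of_norm_lt_one (R := V →L[ℝ] V) (x := T ^ N) hTN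
    -- The right inverse is a partial Neumann sum times the inverse of `1 - T ^ N`.
    have h1 : (1 - T) * ((∑ n ∈ Finset.range N, T ^ n) * ↑u⁻¹) = 1 := by
      rw [← mul_assoc, mul_neg_geom_sum, ← hu, Units.mul_inv]
    set v : V := ((∑ n ∈ Finset.range N, T ^ n) * (↑u⁻¹ : V →L[ℝ] V)) ⟨w, hw⟩
    have h2 : v - T v = ⟨w, hw⟩ := congrArg (fun S : V →L[ℝ] V => S ⟨w, hw⟩) h1
    exact ⟨v, v.2, congrArg Subtype.val h2⟩

/-! ### Operators on the scale and the uniform resolvent bound -/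

namespace Scale

variable {B : Fin 4 → Type*} [∀ i, NormedAddCommGroup (B i)] [∀ i, NormedSpace ℝ (B i)]
variable (X : Scale d r B) {i j k : Fin 4}

lemma emb_incl (hij : (j : ℕ) + 1 = i) (h : B i) : X.emb j (X.incl i j h) = X.emb i h := by
  obtain ⟨J, hJ, -⟩ := X.nested i j hij
  exact Classical.epsilon_spec (p := X.IsIncl i j) ⟨J, hJ⟩ h

lemma norm_incl_le (hij : (j : ℕ) + 1 = i) (h : B i) : ‖X.incl i j h‖ ≤ ‖h‖ := by
  obtain ⟨J, hJ, hn⟩ := X.nested i j hij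
  have : X.incl i j h = J h := X.emb_injective j (by rw [X.emb_incl hij, hJ])
  exact this ▸ hn h

/-- The norm of `B_j` is tested on functions of class `C^{r+1}`. -/
lemma norm_le_of_forall_test {u : B j} {c : ℝ} (hc : 0 ≤ c)
    (h : ∀ φ : Cr d (r + 1), |X.emb j u φ.ofSucc| ≤ c * ‖(X.emb j).flip φ.ofSucc‖) : ‖u‖ ≤ c := by
  have hd : DenseRange fun φ : Cr d (r + 1) => (X.emb j).flip φ.ofSucc :=
    (X.dense_Cr_dual j).comp Cr.denseRange_ofSucc (X.emb j).flip.continuous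
  refine NormedSpace.norm_le_dual_bound ℝ u hc fun ℓ => ?_
  refine hd.induction_on (p := fun ℓ : B j →L[ℝ] ℝ => ‖ℓ u‖ ≤ c * ‖ℓ‖) ℓ ?_ h
  exact isClosed_le (by fun_prop) (by fun_prop)

lemma eq_of_forall_test {u v : B j}
    (h : ∀ φ : Cr d (r + 1), X.emb j u φ.ofSucc = X.emb j v φ.ofSucc) : u = v := by
  rw [← sub_eq_zero, ← norm_le_zero_iff]
  refine X.norm_le_of_forall_test le_rfl fun φ => ?_
  simp [h]

lemma isClosed_zeroMean (i : Fin 4) : IsClosed (X.zeroMean i : Set (B i)) :=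
  ContinuousLinearMap.isClosed_ker ((X.emb i).flip Cr.one)

lemma mem_zeroMean {h : B i} : h ∈ X.zeroMean i ↔ X.int i h = 0 := Iff.rfl

lemma int_sub (g h : B i) : X.int i (g - h) = X.int i g - X.int i h := by simp [int]

lemma int_incl (hij : (j : ℕ) + 1 = i) (h : B i) : X.int j (X.incl i j h) = X.int i h := by
  rw [int, X.emb_incl hij, int]

variable {X} {𝒯 : Set (TorusMap d r)} {K C c₁ c₂ ϑ : ℝ}

namespace Assumptions

variable (hX : X.Assumptions 𝒯 K C c₁ c₂ ϑ)

include hX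

lemma emb_transfer {S : TorusMap d r} (hS : S ∈ 𝒯) (h : B i) (g : Cr d r) :
    X.emb i (X.transfer i S h) g = X.emb i h (g.comp S) :=
  Classical.epsilon_spec (p := X.IsTransfer i S) (hX.transfer_bounded S hS i) h g

lemma emb_partialOp (hij : (j : ℕ) + 1 = i) (k : Fin d) (h : B i) (φ : Cr d (r + 1)) :
    X.emb j (X.partialOp i j k h) φ.ofSucc = -X.emb i h (φ.partialDeriv k) :=
  Classical.epsilon_spec (p := X.IsPartial i j k) (hX.partial_bounded k i j hij) h φ

lemma emb_mulOp (a : CFun d ∞) (h : B i) (φ : Cr d r) :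
    X.emb i (X.mulOp i (Cr.ofSmooth a) h) φ = X.emb i h ((Cr.ofSmooth a).mul φ) := by
  have hq : (0 : ℝ) ≤ c₁ * (i : ℕ) + c₂ :=
    add_nonneg (mul_nonneg hX.c₁_pos.le (Nat.cast_nonneg _)) hX.c₂_pos.le
  obtain ⟨P, hP, -⟩ := hX.mul_bounded i (Cr.ofSmooth a) (CFun.memCq a hq)
  exact Classical.epsilon_spec (p := X.IsMul i (Cr.ofSmooth a)) ⟨P, hP⟩ h φ

lemma incl_mulOp (hij : (j : ℕ) + 1 = i) (a : CFun d ∞) (h : B i) :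
    X.incl i j (X.mulOp i (Cr.ofSmooth a) h) = X.mulOp j (Cr.ofSmooth a) (X.incl i j h) :=
  X.emb_injective j (by ext φ; rw [X.emb_incl hij, hX.emb_mulOp, hX.emb_mulOp, X.emb_incl hij])

lemma incl_transfer (hij : (j : ℕ) + 1 = i) {S : TorusMap d r} (hS : S ∈ 𝒯) (h : B i) :
    X.incl i j (X.transfer i S h) = X.transfer j S (X.incl i j h) :=
  X.emb_injective j
    (by ext φ; rw [X.emb_incl hij, hX.emb_transfer hS, hX.emb_transfer hS, X.emb_incl hij])

lemma int_transfer {S : TorusMap d r} (hS : S ∈ 𝒯) (h : B i) :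
    X.int i (X.transfer i S h) = X.int i h :=
  hX.emb_transfer hS h Cr.one

omit hX in
lemma transferList_replicate (S : TorusMap d r) (n : ℕ) :
    X.transferList i (List.replicate n S) = X.transfer i S ^ n := by
  induction n with
  | zero => rfl
  | succ n ih =>
    rw [List.replicate_succ', transferList, List.foldl_append, pow_succ', ← ih]
    rfl

/-- Lasota–Yorke with the weak norm bounded by the strong one; the constant does not depend on `n`
or `S`. -/
lemma norm_transfer_pow_le (hi : 1 ≤ (i : ℕ)) {S : TorusMap d r} (hS : S ∈ 𝒯) (n : ℕ) (h : B i) :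
    ‖(X.transfer i S ^ n) h‖ ≤ (C + K) * ‖h‖ := by
  obtain ⟨j, hj⟩ : ∃ j : Fin 4, (j : ℕ) + 1 = i :=
    ⟨⟨i - 1, by omega⟩, by simp only; omega⟩
  have h1 := hX.lasota_yorke (List.replicate n S) (fun S' h' => List.eq_of_mem_replicate h' ▸ hS)
    i j hj h
  rw [transferList_replicate, List.length_replicate] at h1
  have h2 := X.norm_incl_le hj h
  have h3 : ϑ ^ n ≤ 1 := pow_le_one₀ hX.ϑ_mem.1.le hX.ϑ_mem.2.le
  have hC : 0 ≤ C := zero_le_one.trans hX.one_le_C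
  have hK : 0 ≤ K := zero_le_one.trans hX.one_le_K
  calc _ ≤ C * ϑ ^ n * ‖h‖ + K * ‖X.incl i j h‖ := h1
    _ ≤ C * 1 * ‖h‖ + K * ‖h‖ := by gcongr
    _ = _ := by ring

lemma norm_transfer_le (hi : 1 ≤ (i : ℕ)) {S : TorusMap d r} (hS : S ∈ 𝒯) (h : B i) :
    ‖X.transfer i S h‖ ≤ (C + K) * ‖h‖ := by
  simpa using hX.norm_transfer_pow_le hi hS 1 h

/-- `Id - ℒ_S` is invertible on the distributions of zero integral in `B_i`, `i ≥ 1`, with a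
bound on the inverse that is uniform in `S`. -/
lemma resolvent [∀ i, CompleteSpace (B i)] : ∃ R : ℝ, 0 ≤ R ∧ ∀ S ∈ 𝒯, ∀ i : Fin 4, 1 ≤ (i : ℕ) →
    (∀ v ∈ X.zeroMean i, ‖v‖ ≤ R * ‖v - X.transfer i S v‖) ∧
    (∀ w ∈ X.zeroMean i, ∃ v ∈ X.zeroMean i, v - X.transfer i S v = w) ∧
    ∀ v ∈ X.zeroMean i, Filter.Tendsto (fun n => (X.transfer i S ^ n) v) Filter.atTop (𝓝 0) := by
  obtain ⟨N, hN⟩ := hX.contraction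
  have hϑ := hX.ϑ_mem
  have hcontr : ∀ S ∈ 𝒯, ∀ i : Fin 4, 1 ≤ (i : ℕ) → ∀ n, N ≤ n → ∀ v ∈ X.zeroMean i,
      ‖(X.transfer i S ^ n) v‖ ≤ ϑ ^ n * ‖v‖ := by
    intro S hS i hi n hn v hv
    have h1 := hN (List.replicate n S) (fun S' h' => List.eq_of_mem_replicate h' ▸ hS)
      (by simpa using hn) i hi
    rw [transferList_replicate, List.length_replicate] at h1
    exact (((X.transfer i S ^ n).comp (X.zeroMean i).subtypeL).le_opNorm ⟨v, hv⟩).trans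
      (mul_le_mul_of_nonneg_right h1.le (norm_nonneg _))
  have hC : 0 ≤ C := zero_le_one.trans hX.one_le_C
  have hK : 0 ≤ K := zero_le_one.trans hX.one_le_K
  -- The exponent `N + 1` keeps the contraction factor below `1` even when `N = 0`.
  have hq1 : ϑ ^ (N + 1) < 1 := pow_lt_one₀ hϑ.1.le hϑ.2 (Nat.succ_ne_zero N)
  refine ⟨(N + 1 : ℕ) * (C + K) / (1 - ϑ ^ (N + 1)),
    div_nonneg (by positivity) (sub_nonneg.2 hq1.le), fun S hS i hi => ?_⟩
  obtain ⟨h1, h2⟩ := resolvent_on_invariant_subspace (X.zeroMean i) (X.isClosed_zeroMean i)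
    (X.transfer i S) (fun v hv => by rw [X.mem_zeroMean, hX.int_transfer hS]; exact hv) hq1 (N + 1)
    (hX.norm_transfer_pow_le hi hS) (hcontr S hS i hi (N + 1) (Nat.le_succ N))
  refine ⟨h1, h2, fun v hv => ?_⟩
  refine squeeze_zero_norm' (Filter.eventually_atTop.2 ⟨N, fun n hn => hcontr S hS i hi n hn v hv⟩) ?_
  simpa using (tendsto_pow_atTop_nhds_zero_of_lt_one hϑ.1.le hϑ.2).mul_const ‖v‖

end Assumptions

end Scale

/-! ### Regularity of the transfer operator in `t` -/

namespace Scale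

variable {B : Fin 4 → Type*} [∀ i, NormedAddCommGroup (B i)] [∀ i, NormedSpace ℝ (B i)]
variable {X : Scale d r B} {i j k : Fin 4}
variable {𝒯 : Set (TorusMap d r)} {K C c₁ c₂ ϑ : ℝ} {M : Model d} {P : Set ℝ}

variable (X M) in
/-- The derivative `h ↦ -∑_k ∂_{x_k} ℒ_t (β_k h)` of the transfer operator `ℒ_t` of
`T + t β` with respect to `t`, from `B_i` to `B_j`. -/
def dTransfer (i j : Fin 4) (t : ℝ) : B i →L[ℝ] B j :=
  -∑ k, (X.partialOp i j k).comp
    ((X.transfer i (M.shift r t)).comp (X.mulOp i (Cr.ofSmooth (M.β k))))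

lemma dTransfer_apply (t : ℝ) (h : B i) : X.dTransfer M i j t h =
    -∑ k, X.partialOp i j k (X.transfer i (M.shift r t) (X.mulOp i (Cr.ofSmooth (M.β k)) h)) := by
  simp [dTransfer]

namespace Assumptions

variable (hX : X.Assumptions 𝒯 K C c₁ c₂ ϑ)

include hX

/-- Two minus signs cancel: the one in `dTransfer` and the one from moving `∂_{x_k}` to the test
function. What remains is the derivative found in `hasDerivAt_integral_comp_shift`. -/
lemma emb_dTransfer (hij : (j : ℕ) + 1 = i) {t : ℝ} (ht : M.shift r t ∈ 𝒯) (h : B i)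
    (φ : Cr d (r + 1)) : X.emb j (X.dTransfer M i j t h) φ.ofSucc =
      ∑ k, X.emb i h ((Cr.ofSmooth (M.β k)).mul ((φ.partialDeriv k).comp (M.shift r t))) := by
  rw [dTransfer_apply, map_neg, map_sum, neg_apply, sum_apply, ← Finset.sum_neg_distrib]
  refine Finset.sum_congr rfl fun k _ => ?_
  rw [hX.emb_partialOp hij, neg_neg, hX.emb_transfer ht, hX.emb_mulOp]

lemma incl_dTransfer (hij : (j : ℕ) + 1 = i) (hjk : (k : ℕ) + 1 = j) {t : ℝ}
    (ht : M.shift r t ∈ 𝒯) (h : B i) :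
    X.incl j k (X.dTransfer M i j t h) = X.dTransfer M j k t (X.incl i j h) := by
  refine X.eq_of_forall_test fun φ => ?_
  rw [X.emb_incl hjk, hX.emb_dTransfer hij ht, hX.emb_dTransfer hjk ht, X.emb_incl hij]

/-- A divergence tested on the constant `1` vanishes. Hence the right-hand side of the response
equation lies where `Id - ℒ_t` is invertible. -/
lemma int_dTransfer (hij : (j : ℕ) + 1 = i) {t : ℝ} (ht : M.shift r t ∈ 𝒯) (h : B i) :
    X.int j (X.dTransfer M i j t h) = 0 := by
  have h1 := hX.emb_dTransfer (M := M) hij ht h Cr.one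
  refine Eq.trans (by rfl) (h1.trans (Finset.sum_eq_zero fun k _ => ?_))
  have h2 : (Cr.ofSmooth (M.β k)).mul (((Cr.one : Cr d (r + 1)).partialDeriv k).comp
      (M.shift r t)) = 0 := by
    ext x
    have h3 : Cr.partialFun k (fun _ : Torus d => (1 : ℝ)) = fun _ => 0 := by
      funext y
      have : per (fun _ : Torus d => (1 : ℝ)) = fun _ => 1 := rfl
      simp [Cr.partialFun, this]
    show (M.β k).1 x * Cr.partialFun k (fun _ => (1 : ℝ)) _ = 0
    rw [h3, mul_zero]
  rw [h2, map_zero]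

lemma norm_dTransfer_le (hij : (j : ℕ) + 1 = i) (M : Model d) : ∃ c : ℝ, 0 ≤ c ∧
    ∀ t, M.shift r t ∈ 𝒯 → ∀ h, ‖X.dTransfer M i j t h‖ ≤ c * ‖h‖ := by
  have hCK : 0 ≤ C + K := add_nonneg (zero_le_one.trans hX.one_le_C) (zero_le_one.trans hX.one_le_K)
  refine ⟨∑ k, ‖X.partialOp i j k‖ * ((C + K) * ‖X.mulOp i (Cr.ofSmooth (M.β k))‖),
    by positivity, fun t ht h => ?_⟩
  rw [dTransfer_apply, norm_neg, Finset.sum_mul]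
  refine (norm_sum_le _ _).trans (Finset.sum_le_sum fun k _ => ?_)
  rw [mul_assoc, mul_assoc]
  refine ContinuousLinearMap.le_opNorm_of_le _
    ((hX.norm_transfer_le (by omega) ht _).trans ?_)
  gcongr
  exact ContinuousLinearMap.le_opNorm _ _

/-- The derivative of `t ↦ ∫ φ ∘ (T + t β) · f` for a function `f`. -/
lemma hasDerivAt_emb_comp_shift (hij : (j : ℕ) + 1 = i) {t : ℝ} (ht : M.shift r t ∈ 𝒯) {h : B i}
    {f : Cr d r} (hf : ∀ φ, X.emb i h φ = ∫ x, f x * φ x) (φ : Cr d (r + 1)) :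
    HasDerivAt (fun τ => X.emb i h (φ.ofSucc.comp (M.shift r τ)))
      (X.emb j (X.dTransfer M i j t h) φ.ofSucc) t := by
  rw [hX.emb_dTransfer hij ht]
  simp only [hf]
  exact hasDerivAt_integral_comp_shift M f φ t

/-- The transfer operator of `T + t β` is Lipschitz in `t`, from `B_i` to `B_{i-1}`. -/
lemma lipschitz_transfer (hij : (j : ℕ) + 1 = i) (hP : Convex ℝ P)
    (hS : ∀ t ∈ P, M.shift r t ∈ 𝒯) : ∃ c : ℝ, 0 ≤ c ∧ ∀ t ∈ P, ∀ t' ∈ P, ∀ h : B i,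
      ‖X.incl i j (X.transfer i (M.shift r t) h - X.transfer i (M.shift r t') h)‖ ≤
        c * |t - t'| * ‖h‖ := by
  obtain ⟨c, hc, hb⟩ := hX.norm_dTransfer_le hij M
  refine ⟨c, hc, fun t ht t' ht' h => ?_⟩
  -- Both sides are continuous in `h`, so `h` may be a function, for which the tested quantity is
  -- differentiable in `t`.
  refine (X.dense_Cr i).induction (P := fun h =>
    ‖X.incl i j (X.transfer i (M.shift r t) h - X.transfer i (M.shift r t') h)‖ ≤
      c * |t - t'| * ‖h‖) ?_ (isClosed_le (by fun_prop) (by fun_prop)) h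
  rintro h ⟨f, hf⟩
  refine X.norm_le_of_forall_test (by positivity) fun φ => ?_
  have h1 := hP.norm_image_sub_le_of_norm_hasDerivWithin_le (C := c * ‖h‖ * ‖(X.emb j).flip φ.ofSucc‖)
    (fun τ hτ => (hX.hasDerivAt_emb_comp_shift hij (hS τ hτ) hf φ).hasDerivWithinAt)
    (fun τ hτ => ?_) ht' ht
  · rw [X.emb_incl hij, map_sub, sub_apply, hX.emb_transfer (hS t ht),
      hX.emb_transfer (hS t' ht')]
    refine h1.trans_eq ?_
    rw [Real.norm_eq_abs]
    ring
  · refine (((X.emb j).flip φ.ofSucc).le_opNorm (X.dTransfer M i j τ h)).trans ?_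
    rw [mul_comm]
    gcongr
    exact hb τ (hS τ hτ) h

/-- The Taylor expansion of order one of the transfer operator of `T + t β` in `t`, from `B_i` to
`B_{i-2}`. -/
lemma taylor_transfer (hij : (j : ℕ) + 1 = i) (hjk : (k : ℕ) + 1 = j) (hP : Convex ℝ P)
    (hS : ∀ t ∈ P, M.shift r t ∈ 𝒯) : ∃ c : ℝ, 0 ≤ c ∧ ∀ t ∈ P, ∀ t' ∈ P, ∀ h : B i,
      ‖X.incl j k (X.incl i j (X.transfer i (M.shift r t) h - X.transfer i (M.shift r t') h)) -
          (t - t') • X.incl j k (X.dTransfer M i j t' h)‖ ≤ c * |t - t'| ^ 2 * ‖h‖ := by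
  obtain ⟨c, hc, hb⟩ := hX.lipschitz_transfer hij hP hS
  set a : ℝ := ∑ l, ‖X.partialOp j k l‖ * (c * ‖X.mulOp i (Cr.ofSmooth (M.β l))‖)
  have ha : 0 ≤ a := by positivity
  -- The derivative is itself Lipschitz in `t`, at the cost of one more level.
  have hlip : ∀ t ∈ P, ∀ t' ∈ P, ∀ h : B i,
      ‖X.incl j k (X.dTransfer M i j t h) - X.incl j k (X.dTransfer M i j t' h)‖ ≤
        a * |t - t'| * ‖h‖ := by
    intro t ht t' ht' h
    rw [hX.incl_dTransfer hij hjk (hS t ht), hX.incl_dTransfer hij hjk (hS t' ht'),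
      dTransfer_apply, dTransfer_apply, neg_sub_neg, ← Finset.sum_sub_distrib, Finset.sum_mul,
      Finset.sum_mul]
    refine (norm_sum_le _ _).trans (Finset.sum_le_sum fun l _ => ?_)
    rw [← map_sub, ← hX.incl_mulOp hij, ← hX.incl_transfer hij (hS t ht),
      ← hX.incl_transfer hij (hS t' ht'), ← map_sub, mul_assoc, mul_assoc]
    refine (X.partialOp j k l).le_opNorm_of_le ((hb t' ht' t ht _).trans ?_)
    rw [abs_sub_comm]
    calc c * |t - t'| * ‖X.mulOp i (Cr.ofSmooth (M.β l)) h‖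
        ≤ c * |t - t'| * (‖X.mulOp i (Cr.ofSmooth (M.β l))‖ * ‖h‖) :=
          mul_le_mul_of_nonneg_left ((X.mulOp i _).le_opNorm h) (by positivity)
      _ = _ := by ring
  refine ⟨a, ha, fun t ht t' ht' h => ?_⟩
  refine (X.dense_Cr i).induction (P := fun h =>
    ‖X.incl j k (X.incl i j (X.transfer i (M.shift r t) h - X.transfer i (M.shift r t') h)) -
      (t - t') • X.incl j k (X.dTransfer M i j t' h)‖ ≤ a * |t - t'| ^ 2 * ‖h‖) ?_
    (isClosed_le (by fun_prop) (by fun_prop)) h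
  rintro h ⟨f, hf⟩
  refine X.norm_le_of_forall_test (by positivity) fun φ => ?_
  -- The linear part is subtracted before the mean value inequality. Restricting to the ball of
  -- radius `|t - t'|` makes the remaining derivative `O(|t - t'|)`, whence the square.
  have h1 := (hP.inter (convex_closedBall t' |t - t'|)).norm_image_sub_le_of_norm_hasDerivWithin_le
    (f := fun τ => X.emb i h (φ.ofSucc.comp (M.shift r τ)) -
      τ * X.emb k (X.incl j k (X.dTransfer M i j t' h)) φ.ofSucc)
    (f' := fun τ => X.emb j (X.dTransfer M i j τ h) φ.ofSucc -
      1 * X.emb k (X.incl j k (X.dTransfer M i j t' h)) φ.ofSucc)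
    (C := a * |t - t'| * ‖h‖ * ‖(X.emb k).flip φ.ofSucc‖)
    (fun τ hτ => ((hX.hasDerivAt_emb_comp_shift hij (hS τ hτ.1) hf φ).sub
      ((hasDerivAt_id τ).mul_const _)).hasDerivWithinAt)
    (fun τ hτ => ?_) ⟨ht', Metric.mem_closedBall_self (abs_nonneg _)⟩ ⟨ht, (Real.dist_eq t t').le⟩
  · rw [map_sub, map_smul, sub_apply, smul_apply, X.emb_incl hjk, X.emb_incl hij, map_sub, sub_apply,
      hX.emb_transfer (hS t ht), hX.emb_transfer (hS t' ht'), smul_eq_mul]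
    refine Eq.trans_le ?_ (h1.trans_eq ?_)
    · rw [Real.norm_eq_abs]
      congr 1
      ring
    · rw [Real.norm_eq_abs]
      ring
  · rw [one_mul, ← X.emb_incl hjk, ← sub_apply, ← map_sub, mul_comm]
    refine (((X.emb k).flip φ.ofSucc).le_opNorm _).trans ?_
    gcongr
    refine (hlip τ hτ.1 t' ht' h).trans ?_
    have h2 : |τ - t'| ≤ |t - t'| := hτ.2
    gcongr

end Assumptions

end Scale

/-- A uniform quadratic Taylor estimate implies continuous differentiability. -/
lemma contDiff_of_quadratic_estimate {E : Type*} [NormedAddCommGroup E] [NormedSpace ℝ E]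
    {P : Set ℝ} {m θ : ℝ → E} {c : ℝ}
    (h : ∀ t ∈ P, ∀ s ∈ P, ‖m t - m s - (t - s) • θ s‖ ≤ c * |t - s| ^ 2) :
    (∀ s ∈ P, HasDerivWithinAt m (θ s) P s) ∧ ContinuousOn θ P := by
  constructor
  · intro s hs
    rw [hasDerivWithinAt_iff_isLittleO]
    refine Asymptotics.IsBigO.trans_isLittleO (g := fun t => (t - s) ^ 2) ?_ ?_
    · refine Asymptotics.IsBigO.of_bound c (Filter.eventually_of_mem self_mem_nhdsWithin fun t ht => ?_)
      rw [norm_pow, Real.norm_eq_abs]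
      exact h t ht s hs
    · have h1 : (fun t : ℝ => (t - s) ^ 2) =o[𝓝 s] fun t => t - s := by
        simpa using Asymptotics.isLittleO_pow_sub_sub s (one_lt_two)
      exact h1.mono nhdsWithin_le_nhds
  · have hlip : ∀ t ∈ P, ∀ s ∈ P, ‖θ t - θ s‖ ≤ 2 * c * |t - s| := by
      intro t ht s hs
      rcases eq_or_ne t s with rfl | hts
      · simp
      have h0 : 0 < |t - s| := abs_pos.2 (sub_ne_zero.2 hts)
      have h1 := h t ht s hs
      have h2 := h s hs t ht
      rw [abs_sub_comm] at h2
      -- Adding the estimate to the one with `t` and `s` exchanged cancels `m` and leaves a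
      -- Lipschitz bound for `θ`.
      have h3 : (t - s) • (θ t - θ s) =
          (m t - m s - (t - s) • θ s) + (m s - m t - (s - t) • θ t) := by module
      have h4 : |t - s| * ‖θ t - θ s‖ ≤ |t - s| * (2 * c * |t - s|) := by
        rw [← Real.norm_eq_abs (t - s), ← norm_smul, h3, Real.norm_eq_abs]
        refine (norm_add_le _ _).trans ((add_le_add h1 h2).trans_eq (by ring))
      exact le_of_mul_le_mul_left h4 h0
    intro s hs
    rw [ContinuousWithinAt, tendsto_iff_norm_sub_tendsto_zero]
    refine squeeze_zero' (Filter.Eventually.of_forall fun _ => norm_nonneg _)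
      (Filter.eventually_of_mem self_mem_nhdsWithin fun t ht => hlip t ht s hs) ?_
    have h1 : Continuous fun t : ℝ => 2 * c * |t - s| := by fun_prop
    simpa using (h1.tendsto s).mono_left nhdsWithin_le_nhds

/-! ### Invariant measures and linear response -/

namespace Scale

variable {B : Fin 4 → Type*} [∀ i, NormedAddCommGroup (B i)] [∀ i, NormedSpace ℝ (B i)]
variable (X : Scale d r B) {i j k : Fin 4} (M : Model d)

/-- The invariant probability measure of `T + t β` in `B₃`. -/
def invMeasure (t : ℝ) : B 3 := Classical.epsilon fun η =>
  X.Nonneg 3 η ∧ X.int 3 η = 1 ∧ X.transfer 3 (M.shift r t) η = η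

/-- The invariant probability measure of `T + t β`, as an element of `B₁`. -/
def invMeasure₁ (t : ℝ) : B 1 := X.incl 2 1 (X.incl 3 2 (X.invMeasure M t))

/-- The derivative with respect to `t` of the invariant probability measure of `T + t β`. -/
def response (t : ℝ) : B 1 := Classical.epsilon fun θ =>
  θ ∈ X.zeroMean 1 ∧ θ - X.transfer 1 (M.shift r t) θ =
    X.incl 2 1 (X.dTransfer M 3 2 t (X.invMeasure M t))

variable {X M}

lemma H_eq (ν : ℝ) (h : B 1) : X.H M ν h = X.invMeasure M (ν * X.intα M h) := by
  rw [H, invMeasure, map, Model.coupledMap_eq_shift]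

/-- It turns the condition on `Θ` into a condition on the derivative of `t ↦ m(t)`; the minus sign
of `Theta` sits inside `dTransfer`. -/
lemma Theta_eq (ν : ℝ) (h : B 1) : X.Theta M ν h = X.response M (ν * X.intα M h) := by
  rw [Theta, response, dTransfer_apply, divTransfer, H_eq, map, Model.coupledMap_eq_shift, map_neg]

lemma emb_invMeasure₁ (t : ℝ) : X.emb 1 (X.invMeasure₁ M t) = X.emb 3 (X.invMeasure M t) := by
  rw [invMeasure₁, X.emb_incl rfl, X.emb_incl rfl]

lemma exists_one (X : Scale d r B) : ∃ h : B 3, X.Nonneg 3 h ∧ X.int 3 h = 1 := by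
  obtain ⟨h, hh⟩ := X.contains_Cr Cr.one
  refine ⟨h, fun φ hφ => ?_, ?_⟩
  · rw [hh]
    exact integral_nonneg fun x => by simpa [Cr.one] using hφ x
  · have h1 : (volume : Measure (Torus d)) univ = 1 := by
      rw [← pi_univ univ]
      exact (Measure.pi_pi _ _).trans (Finset.prod_eq_one fun _ _ => UnitAddCircle.measure_univ)
    rw [int, hh]
    simp [Cr.one, measureReal_def, h1]

variable {𝒯 : Set (TorusMap d r)} {K C c₁ c₂ ϑ : ℝ} {P : Set ℝ}

namespace Assumptions

variable (hX : X.Assumptions 𝒯 K C c₁ c₂ ϑ)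

include hX

lemma nonneg_transfer_pow {S : TorusMap d r} (hS : S ∈ 𝒯) {h : B i} (hh : X.Nonneg i h) (n : ℕ) :
    X.Nonneg i ((X.transfer i S ^ n) h) := by
  induction n with
  | zero => exact hh
  | succ n ih =>
    intro φ hφ
    rw [pow_succ', mul_apply_eq_comp, hX.emb_transfer hS]
    exact ih _ fun x => hφ _

variable [∀ i, CompleteSpace (B i)]

/-- Lebesgue measure `e` is corrected by the zero-mean solution `v` of `v - ℒ v = ℒ e - e`, so `e +
v` is invariant. It is nonnegative as the weak limit of `ℒ^n e = (e + v) - ℒ^n v`. -/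
lemma exists_invMeasure {S : TorusMap d r} (hS : S ∈ 𝒯) :
    ∃ η : B 3, X.Nonneg 3 η ∧ X.int 3 η = 1 ∧ X.transfer 3 S η = η := by
  obtain ⟨R, -, hR⟩ := hX.resolvent
  obtain ⟨-, hsurj, hlim⟩ := hR S hS 3 (by decide)
  obtain ⟨e, he0, he1⟩ := X.exists_one
  obtain ⟨v, hv, hve⟩ := hsurj (X.transfer 3 S e - e)
    (by rw [X.mem_zeroMean, X.int_sub, hX.int_transfer hS, sub_self])
  have hfix : X.transfer 3 S (e + v) = e + v := by
    rw [map_add, ← sub_eq_zero]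
    have : X.transfer 3 S e = v - X.transfer 3 S v + e := by rw [hve]; abel
    rw [this]; abel
  refine ⟨e + v, fun φ hφ => ?_, ?_, hfix⟩
  · have hpow : ∀ n, (X.transfer 3 S ^ n) (e + v) = e + v := fun n => by
      induction n with
      | zero => rfl
      | succ n ih => rw [pow_succ, mul_apply_eq_comp, hfix, ih]
    have h1 : Filter.Tendsto (fun n => X.emb 3 ((X.transfer 3 S ^ n) e) φ) Filter.atTop
        (𝓝 (X.emb 3 (e + v) φ)) := by
      have h2 := (((X.emb 3).flip φ).continuous.tendsto 0).comp (hlim v hv)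
      have h3 : ∀ n, X.emb 3 ((X.transfer 3 S ^ n) e) φ =
          X.emb 3 (e + v) φ - (X.emb 3).flip φ ((X.transfer 3 S ^ n) v) := fun n => by
        conv_rhs => rw [← hpow n]
        simp
      simp only [h3]
      simpa using h2.const_sub (X.emb 3 (e + v) φ)
    exact ge_of_tendsto' h1 fun n => hX.nonneg_transfer_pow hS he0 n φ hφ
  · have : X.int 3 (e + v) = X.int 3 e + X.int 3 v := by simp [int]
    rw [this, he1, X.mem_zeroMean.1 hv, add_zero]

variable {t : ℝ} (ht : M.shift r t ∈ 𝒯)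

include ht

lemma invMeasure_spec : X.Nonneg 3 (X.invMeasure M t) ∧ X.int 3 (X.invMeasure M t) = 1 ∧
    X.transfer 3 (M.shift r t) (X.invMeasure M t) = X.invMeasure M t :=
  Classical.epsilon_spec (hX.exists_invMeasure ht)

lemma nonneg_invMeasure₁ : X.Nonneg 1 (X.invMeasure₁ M t) := fun φ hφ => by
  rw [emb_invMeasure₁]
  exact (hX.invMeasure_spec ht).1 φ hφ

lemma int_invMeasure₁ : X.int 1 (X.invMeasure₁ M t) = 1 := by
  rw [int, emb_invMeasure₁]
  exact (hX.invMeasure_spec ht).2.1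

lemma transfer_invMeasure₁ :
    X.transfer 1 (M.shift r t) (X.invMeasure₁ M t) = X.invMeasure₁ M t := by
  rw [invMeasure₁, ← hX.incl_transfer rfl ht, ← hX.incl_transfer rfl ht,
    (hX.invMeasure_spec ht).2.2]

/-- The difference is a zero-mean fixed point, hence zero by the resolvent bound; positivity plays
no role. -/
lemma eq_invMeasure₁ {h : B 1} (hh : X.int 1 h = 1) (hfix : X.transfer 1 (M.shift r t) h = h) :
    h = X.invMeasure₁ M t := by
  obtain ⟨R, -, hR⟩ := hX.resolvent
  have h1 := (hR _ ht 1 le_rfl).1 (h - X.invMeasure₁ M t)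
    (by rw [X.mem_zeroMean, X.int_sub, hh, hX.int_invMeasure₁ ht, sub_self])
  rw [map_sub, hfix, hX.transfer_invMeasure₁ ht, sub_self, norm_zero, mul_zero] at h1
  exact sub_eq_zero.1 (norm_le_zero_iff.1 h1)

lemma response_spec : X.response M t ∈ X.zeroMean 1 ∧
    X.response M t - X.transfer 1 (M.shift r t) (X.response M t) =
      X.incl 2 1 (X.dTransfer M 3 2 t (X.invMeasure M t)) := by
  obtain ⟨R, -, hR⟩ := hX.resolvent
  obtain ⟨θ, h1, h2⟩ := (hR _ ht 1 le_rfl).2.1 (X.incl 2 1 (X.dTransfer M 3 2 t (X.invMeasure M t)))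
    (by rw [X.mem_zeroMean, X.int_incl rfl, hX.int_dTransfer rfl ht])
  exact Classical.epsilon_spec (p := fun θ => θ ∈ X.zeroMean 1 ∧
    θ - X.transfer 1 (M.shift r t) θ =
      X.incl 2 1 (X.dTransfer M 3 2 t (X.invMeasure M t))) ⟨θ, h1, h2⟩

omit ht in
lemma norm_invMeasure_le : ∃ c : ℝ, 0 ≤ c ∧
    ∀ t, M.shift r t ∈ 𝒯 → ‖X.invMeasure M t‖ ≤ c := by
  obtain ⟨R, hR0, hR⟩ := hX.resolvent
  obtain ⟨e, -, he1⟩ := X.exists_one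
  have hCK : 0 ≤ C + K := add_nonneg (zero_le_one.trans hX.one_le_C) (zero_le_one.trans hX.one_le_K)
  refine ⟨‖e‖ + R * ((C + K) * ‖e‖ + ‖e‖), by positivity, fun t ht => ?_⟩
  obtain ⟨-, hint, hfix⟩ := hX.invMeasure_spec ht
  have h1 := (hR _ ht 3 (by decide)).1 (X.invMeasure M t - e)
    (by rw [X.mem_zeroMean, X.int_sub, hint, he1, sub_self])
  have h2 : X.invMeasure M t - e - X.transfer 3 (M.shift r t) (X.invMeasure M t - e) =
      X.transfer 3 (M.shift r t) e - e := by
    rw [map_sub, hfix]; abel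
  rw [h2] at h1
  calc ‖X.invMeasure M t‖ = ‖e + (X.invMeasure M t - e)‖ := by congr 1; abel
    _ ≤ ‖e‖ + ‖X.invMeasure M t - e‖ := norm_add_le _ _
    _ ≤ _ := by
      gcongr
      refine h1.trans (mul_le_mul_of_nonneg_left ((norm_sub_le _ _).trans ?_) hR0)
      gcongr
      exact hX.norm_transfer_le (by decide) ht e

omit ht in
/-- Linear response: the invariant measure of `T + t β` is differentiable in `t`, with derivative
`response`. -/
lemma linear_response (hP : Convex ℝ P) (hS : ∀ t ∈ P, M.shift r t ∈ 𝒯) :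
    ∃ c : ℝ, ∀ t ∈ P, ∀ s ∈ P,
      ‖X.invMeasure₁ M t - X.invMeasure₁ M s - (t - s) • X.response M s‖ ≤ c * |t - s| ^ 2 := by
  obtain ⟨R, hR0, hR⟩ := hX.resolvent
  obtain ⟨b, hb0, hb⟩ := hX.norm_invMeasure_le (M := M)
  obtain ⟨a₃, ha₃, h₃⟩ := hX.lipschitz_transfer (i := 3) (j := 2) rfl hP hS
  obtain ⟨a₂, ha₂, h₂⟩ := hX.lipschitz_transfer (i := 2) (j := 1) rfl hP hS
  obtain ⟨a, ha, hT⟩ := hX.taylor_transfer (i := 3) (j := 2) (k := 1) rfl rfl hP hS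
  -- From `(Id - ℒ_t)(m_t - m_s) = (ℒ_t - ℒ_s) m_s` in `B₂`.
  have hlip : ∀ t ∈ P, ∀ s ∈ P,
      ‖X.incl 3 2 (X.invMeasure M t) - X.incl 3 2 (X.invMeasure M s)‖ ≤
        R * (a₃ * |t - s| * b) := by
    intro t ht s hs
    obtain ⟨-, hit, hft⟩ := hX.invMeasure_spec (hS t ht)
    obtain ⟨-, his, hfs⟩ := hX.invMeasure_spec (hS s hs)
    have h1 := (hR _ (hS t ht) 2 (by decide)).1
      (X.incl 3 2 (X.invMeasure M t) - X.incl 3 2 (X.invMeasure M s))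
      (by rw [X.mem_zeroMean, X.int_sub, X.int_incl rfl, X.int_incl rfl, hit, his, sub_self])
    refine h1.trans (mul_le_mul_of_nonneg_left ?_ hR0)
    refine Eq.trans_le ?_ ((h₃ t ht s hs (X.invMeasure M s)).trans
      (mul_le_mul_of_nonneg_left (hb s (hS s hs)) (by positivity)))
    rw [hfs, map_sub, map_sub, ← hX.incl_transfer rfl (hS t ht), ← hX.incl_transfer rfl (hS t ht),
      hft]
    congr 1; abel
  refine ⟨R * (a * b + a₂ * (R * (a₃ * b))), fun t ht s hs => ?_⟩
  obtain ⟨hθ, hθe⟩ := hX.response_spec (hS s hs)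
  set L := X.transfer 1 (M.shift r s)
  have h1 := (hR _ (hS s hs) 1 le_rfl).1
    (X.invMeasure₁ M t - X.invMeasure₁ M s - (t - s) • X.response M s)
    (Submodule.sub_mem _ (by rw [X.mem_zeroMean, X.int_sub, hX.int_invMeasure₁ (hS t ht),
      hX.int_invMeasure₁ (hS s hs), sub_self]) (Submodule.smul_mem _ _ hθ))
  have hT' := hT t ht s hs (X.invMeasure M s)
  have h₂' := h₂ t ht s hs (X.incl 3 2 (X.invMeasure M t) - X.incl 3 2 (X.invMeasure M s))
  -- Applying `Id - ℒ_s` leaves the Taylor remainder of `ℒ` at `m_s`, from `B₃` to `B₁`, plus `(ℒ_t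
  -- - ℒ_s)(m_t - m_s)`, a product of two Lipschitz bounds. Both are quadratic in `t - s`.
  have e1 : X.invMeasure₁ M t - X.invMeasure₁ M s - (t - s) • X.response M s -
      L (X.invMeasure₁ M t - X.invMeasure₁ M s - (t - s) • X.response M s) =
      (X.incl 2 1 (X.incl 3 2 (X.transfer 3 (M.shift r t) (X.invMeasure M s) -
        X.transfer 3 (M.shift r s) (X.invMeasure M s))) -
          (t - s) • X.incl 2 1 (X.dTransfer M 3 2 s (X.invMeasure M s))) +
      X.incl 2 1 (X.transfer 2 (M.shift r t)
          (X.incl 3 2 (X.invMeasure M t) - X.incl 3 2 (X.invMeasure M s)) -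
        X.transfer 2 (M.shift r s)
          (X.incl 3 2 (X.invMeasure M t) - X.incl 3 2 (X.invMeasure M s))) := by
    have hm : ∀ τ, X.incl 2 1 (X.incl 3 2 (X.invMeasure M τ)) = X.invMeasure₁ M τ := fun _ => rfl
    have et := hX.transfer_invMeasure₁ (hS t ht)
    rw [← hθe]
    simp only [map_sub, map_smul, hX.incl_transfer (i := 3) (j := 2) rfl (hS t ht),
      hX.incl_transfer (i := 3) (j := 2) rfl (hS s hs),
      hX.incl_transfer (i := 2) (j := 1) rfl (hS t ht),
      hX.incl_transfer (i := 2) (j := 1) rfl (hS s hs)]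
    simp only [hm, et, L]
    rw [hX.transfer_invMeasure₁ (hS s hs), smul_sub]
    abel
  rw [show X.transfer 1 (M.shift r s) = L from rfl, e1] at h1
  refine h1.trans ?_
  rw [mul_assoc]
  refine mul_le_mul_of_nonneg_left ((norm_add_le _ _).trans ?_) hR0
  calc _ ≤ a * |t - s| ^ 2 * b + a₂ * |t - s| * (R * (a₃ * |t - s| * b)) := by
        refine add_le_add (hT'.trans ?_) (h₂'.trans ?_)
        · exact mul_le_mul_of_nonneg_left (hb s (hS s hs)) (by positivity)
        · exact mul_le_mul_of_nonneg_left (hlip t ht s hs) (by positivity)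
    _ = _ := by ring

end Assumptions

end Scale

/-! ### The scalar equation `t = ν a(t)` and its maximal branches -/

lemma contDiffOn_one_of_hasDerivWithinAt {E : Type*} [NormedAddCommGroup E] [NormedSpace ℝ E]
    {f f' : ℝ → E} {s : Set ℝ} (hd : ∀ t ∈ s, HasDerivWithinAt f (f' t) s t)
    (hc : ContinuousOn f' s) : ContDiffOn ℝ 1 f s := by
  refine (contDiffOn_succ_iff_hasFDerivWithinAt (n := 0) (by simp)).2 fun t ht =>
    ⟨s, by rw [insert_eq_of_mem ht]; exact self_mem_nhdsWithin, by simp,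
      fun t => ContinuousLinearMap.toSpanSingleton ℝ (f' t), fun t ht => (hd t ht).hasFDerivWithinAt,
      contDiffOn_zero.2 ?_⟩
  exact (ContinuousLinearMap.toSpanSingletonCLE (𝕜 := ℝ) (E := E)).continuous.comp_continuousOn hc

/-- Relatively closed subsets of `s` are compact, so their images are closed. -/
lemma continuousOn_image_of_leftInvOn_of_isCompact {X Y : Type*} [TopologicalSpace X]
    [TopologicalSpace Y] [T2Space Y] {f : X → Y} {g : Y → X} {s : Set X} (hs : IsCompact s)
    (hf : ContinuousOn f s) (hg : LeftInvOn g f s) : ContinuousOn g (f '' s) := by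
  refine continuousOn_iff_isClosed.2 fun t ht =>
    ⟨f '' (s ∩ t), ((hs.inter_right ht).image_of_continuousOn (hf.mono inter_subset_left)).isClosed,
      ?_⟩
  ext y
  constructor
  · rintro ⟨hy, x, hx, rfl⟩
    rw [mem_preimage, hg hx] at hy
    exact ⟨⟨x, ⟨hx, hy⟩, rfl⟩, x, hx, rfl⟩
  · rintro ⟨⟨x, ⟨hx, hxt⟩, rfl⟩, h⟩
    exact ⟨by rw [mem_preimage, hg hx]; exact hxt, h⟩

/-- The inverse of a function on a compact interval whose derivative does not vanish in the
interior. -/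
lemma exists_inverse_of_deriv_ne_zero {p q : ℝ} (hpq : p < q) {N N' : ℝ → ℝ}
    (hN : ContinuousOn N (Icc p q)) (hd : ∀ t ∈ Ioo p q, HasDerivAt N (N' t) t)
    (hN' : ContinuousOn N' (Ioo p q)) (hne : ∀ t ∈ Ioo p q, N' t ≠ 0) :
    ∃ (ν₁ ν₂ : ℝ) (τ : ℝ → ℝ), ν₁ < ν₂ ∧ (ν₁ = N p ∧ ν₂ = N q ∨ ν₁ = N q ∧ ν₂ = N p) ∧
      (∀ ν ∈ Icc ν₁ ν₂, τ ν ∈ Icc p q ∧ N (τ ν) = ν) ∧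
      (∀ t ∈ Ioo p q, N t ∈ Ioo ν₁ ν₂ ∧ τ (N t) = t) ∧ (∀ ν ∈ Ioo ν₁ ν₂, τ ν ∈ Ioo p q) ∧
      ContinuousOn τ (Icc ν₁ ν₂) ∧ ContDiffOn ℝ 1 τ (Ioo ν₁ ν₂) := by
  have hp : p ∈ Icc p q := left_mem_Icc.2 hpq.le
  have hq : q ∈ Icc p q := right_mem_Icc.2 hpq.le
  obtain ⟨ν₁, ν₂, hlt, hor, hinj, himg⟩ : ∃ ν₁ ν₂, ν₁ < ν₂ ∧
      (ν₁ = N p ∧ ν₂ = N q ∨ ν₁ = N q ∧ ν₂ = N p) ∧ InjOn N (Icc p q) ∧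
      N '' Icc p q = Icc ν₁ ν₂ := by
    -- Darboux: a derivative without zeros has constant sign.
    rcases hasDerivWithinAt_forall_lt_or_forall_gt_of_forall_ne (convex_Ioo p q)
      (fun t ht => (hd t ht).hasDerivWithinAt) hne with h | h
    · have hmono : StrictAntiOn N (Icc p q) := strictAntiOn_of_deriv_neg (convex_Icc p q) hN
        fun t ht => by
          rw [interior_Icc] at ht
          rw [(hd t ht).deriv]
          exact h t ht
      refine ⟨N q, N p, hmono hp hq hpq, Or.inr ⟨rfl, rfl⟩, hmono.injOn, Subset.antisymm ?_
        (intermediate_value_Icc' hpq.le hN)⟩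
      rintro _ ⟨t, ht, rfl⟩
      exact ⟨hmono.antitoneOn ht hq ht.2, hmono.antitoneOn hp ht ht.1⟩
    · have hmono : StrictMonoOn N (Icc p q) := strictMonoOn_of_deriv_pos (convex_Icc p q) hN
        fun t ht => by
          rw [interior_Icc] at ht
          rw [(hd t ht).deriv]
          exact h t ht
      refine ⟨N p, N q, hmono hp hq hpq, Or.inl ⟨rfl, rfl⟩, hmono.injOn, Subset.antisymm ?_
        (intermediate_value_Icc hpq.le hN)⟩
      rintro _ ⟨t, ht, rfl⟩
      exact ⟨hmono.monotoneOn hp ht ht.1, hmono.monotoneOn ht hq ht.2⟩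
  set τ : ℝ → ℝ := Function.invFunOn N (Icc p q)
  have hleft : LeftInvOn τ N (Icc p q) := hinj.leftInvOn_invFunOn
  have hτ : ∀ ν ∈ Icc ν₁ ν₂, τ ν ∈ Icc p q ∧ N (τ ν) = ν := fun ν hν => by
    have hν' : ∃ t ∈ Icc p q, N t = ν := by rwa [← himg] at hν
    exact ⟨Function.invFunOn_mem hν', Function.invFunOn_eq hν'⟩
  have hτc : ContinuousOn τ (Icc ν₁ ν₂) :=
    himg ▸ continuousOn_image_of_leftInvOn_of_isCompact isCompact_Icc hN hleft
  have hends : ∀ t ∈ Icc p q, N t ≠ ν₁ ∧ N t ≠ ν₂ ↔ t ≠ p ∧ t ≠ q := fun t ht => by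
    rcases hor with ⟨rfl, rfl⟩ | ⟨rfl, rfl⟩ <;>
    simp only [ne_eq, hinj.eq_iff ht hp, hinj.eq_iff ht hq]
    tauto
  have hτi : ∀ ν ∈ Ioo ν₁ ν₂, τ ν ∈ Ioo p q := fun ν hν => by
    obtain ⟨h1, h2⟩ := hτ ν (Ioo_subset_Icc_self hν)
    have h3 := (hends _ h1).1 (by rw [h2]; exact ⟨hν.1.ne', hν.2.ne⟩)
    exact ⟨lt_of_le_of_ne h1.1 h3.1.symm, lt_of_le_of_ne h1.2 h3.2⟩
  refine ⟨ν₁, ν₂, τ, hlt, hor, hτ, fun t ht => ⟨?_, hleft (Ioo_subset_Icc_self ht)⟩, hτi, hτc, ?_⟩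
  · have h1 : N t ∈ Icc ν₁ ν₂ := himg ▸ mem_image_of_mem N (Ioo_subset_Icc_self ht)
    have h3 := (hends t (Ioo_subset_Icc_self ht)).2 ⟨ht.1.ne', ht.2.ne⟩
    exact ⟨lt_of_le_of_ne h1.1 h3.1.symm, lt_of_le_of_ne h1.2 h3.2⟩
  · refine contDiffOn_one_of_hasDerivWithinAt (f' := fun ν => (N' (τ ν))⁻¹) (fun ν hν => ?_) ?_
    · refine (HasDerivAt.of_local_left_inverse (hτc.continuousAt (Icc_mem_nhds hν.1 hν.2))
        (hd _ (hτi ν hν)) (hne _ (hτi ν hν)) ?_).hasDerivWithinAt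
      filter_upwards [Icc_mem_nhds hν.1 hν.2] with y hy using (hτ y hy).2
    · exact (hN'.comp (hτc.mono Ioo_subset_Icc_self) hτi).inv₀ fun ν hν => hne _ (hτi ν hν)

/-- The data of a maximal `C^1` branch `τ` of solutions of `t = ν a(t)` through `(ν₀, t₀)`. -/
def HasMaximalBranch (J : Set ℝ) (νs : ℝ) (a a' : ℝ → ℝ) (ν₀ t₀ : ℝ) : Prop :=
  ∃ (ν₁ ν₂ : ℝ) (τ : ℝ → ℝ), Icc ν₁ ν₂ ⊆ Icc 0 νs ∧ ν₀ ∈ Ioo ν₁ ν₂ ∧ τ ν₀ = t₀ ∧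
    ContinuousOn τ (Icc ν₁ ν₂) ∧ ContDiffOn ℝ 1 τ (Ioo ν₁ ν₂) ∧
    (∀ ν ∈ Icc ν₁ ν₂, τ ν ∈ J ∧ τ ν = ν * a (τ ν)) ∧
    (∀ ν ∈ Ioo ν₁ ν₂, ν * a' (τ ν) ≠ 1) ∧
    (ν₁ = 0 ∨ ν₁ * a' (τ ν₁) = 1) ∧ (ν₂ = νs ∨ ν₂ * a' (τ ν₂) = 1)

/-- The branch of the solution `t = 0`. -/
lemma hasMaximalBranch_zero {J : Set ℝ} {νs ν₀ : ℝ} {a a' : ℝ → ℝ} (h0 : (0 : ℝ) ∈ J)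
    (hν₀ : ν₀ ∈ Ioo 0 νs) (ha : a 0 = 0) (hreg : ν₀ * a' 0 ≠ 1) :
    HasMaximalBranch J νs a a' ν₀ 0 := by
  suffices h : ∃ ν₁ ν₂, 0 ≤ ν₁ ∧ ν₂ ≤ νs ∧ ν₀ ∈ Ioo ν₁ ν₂ ∧ (∀ ν ∈ Ioo ν₁ ν₂, ν * a' 0 ≠ 1) ∧
      (ν₁ = 0 ∨ ν₁ * a' 0 = 1) ∧ (ν₂ = νs ∨ ν₂ * a' 0 = 1) by
    obtain ⟨ν₁, ν₂, h1, h2, h3, h4, h5, h6⟩ := h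
    exact ⟨ν₁, ν₂, fun _ => 0, Icc_subset_Icc h1 h2, h3, rfl, continuousOn_const, contDiffOn_const,
      fun ν _ => ⟨h0, by simp [ha]⟩, h4, h5, h6⟩
  by_cases hc : a' 0 = 0
  · exact ⟨0, νs, le_rfl, le_rfl, hν₀, fun ν _ => by simp [hc], Or.inl rfl, Or.inl rfl⟩
  -- Along `t = 0` only `ν = (a' 0)⁻¹` is degenerate; `[0, νs]` is cut there if that point lies
  -- inside.
  have hiff : ∀ ν, ν * a' 0 = 1 ↔ ν = (a' 0)⁻¹ := fun ν => mul_eq_one_iff_eq_inv₀ hc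
  simp only [ne_eq, hiff] at hreg ⊢
  rcases lt_or_gt_of_ne hreg with h | h
  · rcases le_total νs (a' 0)⁻¹ with h' | h'
    · exact ⟨0, νs, le_rfl, le_rfl, hν₀, fun ν hν => (hν.2.trans_le h').ne, Or.inl rfl, Or.inl rfl⟩
    · exact ⟨0, _, le_rfl, h', ⟨hν₀.1, h⟩, fun ν hν => hν.2.ne, Or.inl rfl, Or.inr rfl⟩
  · rcases le_total (a' 0)⁻¹ 0 with h' | h'
    · exact ⟨0, νs, le_rfl, le_rfl, hν₀, fun ν hν => (h'.trans_lt hν.1).ne', Or.inl rfl, Or.inl rfl⟩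
    · exact ⟨_, νs, h', le_rfl, ⟨h, hν₀.2⟩, fun ν hν => hν.1.ne', Or.inr rfl, Or.inl rfl⟩

/-- The equation is invariant under `t ↦ -t` and `a ↦ -a(-·)`, which takes `a'` to `a'(-·)`. -/
lemma HasMaximalBranch.neg {J : Set ℝ} {νs ν₀ t₀ : ℝ} {a a' : ℝ → ℝ}
    (h : HasMaximalBranch (-J) νs (fun t => -a (-t)) (fun t => a' (-t)) ν₀ (-t₀)) :
    HasMaximalBranch J νs a a' ν₀ t₀ := by
  obtain ⟨ν₁, ν₂, τ, h1, h2, h3, h4, h5, h6, h7, h8, h9⟩ := h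
  refine ⟨ν₁, ν₂, fun ν => -τ ν, h1, h2, by simp [h3], h4.neg, h5.neg, fun ν hν => ?_, h7, h8, h9⟩
  obtain ⟨e1, e2⟩ := h6 ν hν
  exact ⟨e1, by linarith⟩

/-- The branch is the inverse of `N(t) = t / a(t)`. Zeros of `G` are the critical points of `N`
where `a ≠ 0`; zeros of `g` with `a ≠ 0` are the points with `N = νs`. The interval `(p, q)` extends
from `t₀` to the nearest such zero, or down to `t = 0`. The hypothesis `hb` says `g b ≤ 0`, so a
right end exists. -/
lemma hasMaximalBranch_of_pos {b νs ν₀ t₀ : ℝ} {a a' : ℝ → ℝ}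
    (hd : ∀ t ∈ Icc 0 b, HasDerivWithinAt a (a' t) (Icc 0 b) t) (ha' : ContinuousOn a' (Icc 0 b))
    (hb : νs * a b ≤ b) (hν₀ : ν₀ ∈ Ioo 0 νs) (ht₀ : 0 < t₀) (htb : t₀ ≤ b)
    (hfix : t₀ = ν₀ * a t₀) (hreg : ν₀ * a' t₀ ≠ 1) :
    HasMaximalBranch (Icc 0 b) νs a a' ν₀ t₀ := by
  have hac : ContinuousOn a (Icc 0 b) := fun t ht => (hd t ht).continuousWithinAt
  have hνs : 0 < νs := hν₀.1.trans hν₀.2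
  have hat₀ : 0 < a t₀ := pos_of_mul_pos_right (hfix ▸ ht₀) hν₀.1.le
  have ht₀mem : t₀ ∈ Icc 0 b := ⟨ht₀.le, htb⟩
  set G : ℝ → ℝ := fun t => a t - t * a' t with hG
  set g : ℝ → ℝ := fun t => νs * a t - t with hg
  have hGc : ContinuousOn G (Icc 0 b) := hac.sub (continuousOn_id.mul ha')
  have hgc : ContinuousOn g (Icc 0 b) := (continuousOn_const.mul hac).sub continuousOn_id
  have hgt₀ : 0 < g t₀ := by
    have := mul_lt_mul_of_pos_right hν₀.2 hat₀
    simp only [hg]; linarith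
  have hGt₀ : G t₀ ≠ 0 := by
    have : G t₀ = a t₀ * (1 - ν₀ * a' t₀) := by
      simp only [hG]; linear_combination (-a' t₀) * hfix
    rw [this]
    exact mul_ne_zero hat₀.ne' (sub_ne_zero.2 (Ne.symm hreg))
  have hcl : ∀ s ⊆ Icc 0 b, IsClosed s → IsCompact (s ∩ {t | G t * g t = 0}) := by
    intro s hs hsc
    have : s ∩ {t | G t * g t = 0} = s ∩ (fun t => G t * g t) ⁻¹' {0} := rfl
    rw [this]
    exact isCompact_Icc.of_isClosed_subset
      (((hGc.mul hgc).mono hs).preimage_isClosed_of_isClosed hsc isClosed_singleton)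
      (inter_subset_left.trans hs)
  obtain ⟨q, ⟨hqI, hq0⟩, hqmin⟩ := (hcl (Icc t₀ b) (Icc_subset_Icc_left ht₀.le)
    isClosed_Icc).exists_isLeast (by
      obtain ⟨t, ht, h0⟩ := intermediate_value_Icc' htb (hgc.mono (Icc_subset_Icc_left ht₀.le))
        ⟨by simp only [hg]; linarith, hgt₀.le⟩
      exact ⟨t, ht, by simp [h0]⟩)
  -- Without a zero to the left of `t₀` the interval runs down to `0`.
  obtain ⟨p, ⟨hpI, hp0⟩, hpmax⟩ : ∃ p, (p ∈ Icc 0 t₀ ∧ (p = 0 ∨ G p * g p = 0)) ∧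
      ∀ t ∈ Icc 0 t₀, G t * g t = 0 → t ≤ p := by
    rcases (Icc 0 t₀ ∩ {t | G t * g t = 0}).eq_empty_or_nonempty with he | hne
    · exact ⟨0, ⟨⟨le_rfl, ht₀.le⟩, Or.inl rfl⟩, fun t ht h =>
        absurd (he ▸ (⟨ht, h⟩ : t ∈ Icc 0 t₀ ∩ {t | G t * g t = 0})) (notMem_empty t)⟩
    · obtain ⟨p, ⟨h1, h2⟩, h3⟩ := (hcl (Icc 0 t₀) (Icc_subset_Icc_right htb)
        isClosed_Icc).exists_isGreatest hne
      exact ⟨p, ⟨h1, Or.inr h2⟩, fun t ht h => h3 ⟨ht, h⟩⟩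
  have hGg : G t₀ * g t₀ ≠ 0 := mul_ne_zero hGt₀ hgt₀.ne'
  have htq : t₀ < q := lt_of_le_of_ne hqI.1 fun h => hGg (h ▸ hq0)
  have hpt : p < t₀ := lt_of_le_of_ne hpI.2 fun h => by
    rcases hp0 with h' | h'
    · linarith
    · exact hGg (h ▸ h')
  have hpq : p < q := hpt.trans htq
  have hsub : Icc p q ⊆ Icc 0 b := Icc_subset_Icc hpI.1 hqI.2
  have hne : ∀ t ∈ Ioo p q, G t * g t ≠ 0 := fun t ht h0 => by
    rcases le_total t t₀ with h | h
    · exact absurd (hpmax t ⟨hpI.1.trans ht.1.le, h⟩ h0) ht.1.not_ge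
    · exact absurd (hqmin ⟨⟨h, ht.2.le.trans hqI.2⟩, h0⟩) ht.2.not_ge
  have hgpos : ∀ t ∈ Ioo p q, 0 < g t := fun t ht => by
    by_contra hle
    obtain ⟨s, hs, h0⟩ := (isPreconnected_Ioo (a := p) (b := q)).intermediate_value ht
      (show t₀ ∈ Ioo p q from ⟨hpt, htq⟩) (hgc.mono (Ioo_subset_Icc_self.trans hsub))
      ⟨not_lt.1 hle, hgt₀.le⟩
    exact hne s hs (by rw [h0, mul_zero])
  have hgnn : ∀ t ∈ Icc p q, 0 ≤ g t := by
    have hcl' : IsClosed (Icc p q ∩ g ⁻¹' Ici 0) :=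
      (hgc.mono hsub).preimage_isClosed_of_isClosed isClosed_Icc isClosed_Ici
    have : closure (Ioo p q) ⊆ Icc p q ∩ g ⁻¹' Ici 0 := hcl'.closure_subset_iff.2 fun t ht =>
      ⟨Ioo_subset_Icc_self ht, (hgpos t ht).le⟩
    rw [closure_Ioo hpq.ne] at this
    exact fun t ht => (this ht).2
  have hann : ∀ t ∈ Icc p q, 0 ≤ a t := fun t ht => by
    have h1 := hgnn t ht
    have h2 := (hsub ht).1
    simp only [hg] at h1
    exact nonneg_of_mul_nonneg_right (by linarith : 0 ≤ νs * a t) hνs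
  have hazero : ∀ t ∈ Icc p q, a t = 0 → t = 0 := fun t ht h => by
    have h1 := hgnn t ht
    have h2 := (hsub ht).1
    simp only [hg, h] at h1
    linarith
  have hint : ∀ t ∈ Ioo p q, 0 < t ∧ t < b ∧ 0 < a t := fun t ht => by
    have h1 : 0 < t := hpI.1.trans_lt ht.1
    refine ⟨h1, ht.2.trans_le hqI.2, lt_of_le_of_ne (hann t (Ioo_subset_Icc_self ht)) fun h => ?_⟩
    exact h1.ne' (hazero t (Ioo_subset_Icc_self ht) h.symm)
  -- If `a 0 = 0`, the quotient `t / a t` is indeterminate at `0`. There `a t / t` tends to `a' 0`,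
  -- and `g ≥ 0` keeps this limit at least `1 / νs`.
  have hslope : 0 ∈ Icc p q → a 0 = 0 → p = 0 ∧ 0 < a' 0 ∧ 1 ≤ νs * a' 0 ∧
      Filter.Tendsto (fun t => t / a t) (𝓝[Icc p q \ {0}] 0) (𝓝 (a' 0)⁻¹) := by
    intro h0 ha0
    have hp : p = 0 := le_antisymm h0.1 hpI.1
    have h1 : Filter.Tendsto (fun t => a t / t) (𝓝[Icc p q \ {0}] 0) (𝓝 (a' 0)) := by
      have h2 := hasDerivWithinAt_iff_tendsto_slope.1 ((hd 0 (hsub h0)).mono hsub)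
      refine h2.congr fun t => ?_
      simp [slope_def_field, ha0]
    have h3 : 1 / νs ≤ a' 0 := by
      have : (𝓝[Icc p q \ {0}] (0 : ℝ)).NeBot := by
        rw [← mem_closure_iff_nhdsWithin_neBot]
        refine closure_mono (show Ioo p q ⊆ Icc p q \ {0} from fun t ht =>
          ⟨Ioo_subset_Icc_self ht, (hint t ht).1.ne'⟩) ?_
        rw [closure_Ioo hpq.ne]; exact h0
      refine ge_of_tendsto h1 (Filter.eventually_of_mem self_mem_nhdsWithin fun t ht => ?_)
      have h4 : 0 < t := lt_of_le_of_ne (hsub ht.1).1 (Ne.symm ht.2)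
      have h5 := hgnn t ht.1
      simp only [hg] at h5
      rw [div_le_div_iff₀ hνs h4]
      linarith
    have h6 : 0 < a' 0 := (one_div_pos.2 hνs).trans_le h3
    refine ⟨hp, h6, ?_, ?_⟩
    · rwa [div_le_iff₀' hνs] at h3
    · simpa using h1.inv₀ h6.ne'
  -- On `[p, q]` the first case occurs only at `t = 0`, where the value is the limit of `t / a t`.
  set N : ℝ → ℝ := fun t => if a t = 0 then (a' t)⁻¹ else t / a t with hN
  have hN1 : ∀ t, a t ≠ 0 → N t = t / a t := fun t h => by simp [hN, h]
  have hNc : ContinuousOn N (Icc p q) := by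
    intro t ht
    by_cases h : a t = 0
    · obtain rfl := hazero t ht h
      obtain ⟨-, -, -, h2⟩ := hslope ht h
      rw [← continuousWithinAt_sdiff_self]
      show Filter.Tendsto N _ (𝓝 (N 0))
      rw [show N 0 = (a' 0)⁻¹ by simp [hN, h]]
      refine h2.congr' (Filter.eventually_of_mem self_mem_nhdsWithin fun s hs => ?_)
      exact (hN1 s fun h' => hs.2 (hazero s hs.1 h')).symm
    · have h1 : ContinuousWithinAt a (Icc p q) t := (hac t (hsub ht)).mono hsub
      refine (continuousWithinAt_id.div h1 h).congr_of_eventuallyEq ?_ (hN1 t h)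
      filter_upwards [h1.eventually_ne h] with s hs using hN1 s hs
  have hda : ∀ t ∈ Ioo p q, HasDerivAt a (a' t) t := fun t ht =>
    (hd t (hsub (Ioo_subset_Icc_self ht))).hasDerivAt
      (Icc_mem_nhds (hint t ht).1 (hint t ht).2.1)
  have hNd : ∀ t ∈ Ioo p q, HasDerivAt N (G t / a t ^ 2) t := fun t ht => by
    have h1 := (hasDerivAt_id t).div (hda t ht) (hint t ht).2.2.ne'
    refine (h1.congr_of_eventuallyEq ?_).congr_deriv (by simp [hG])
    filter_upwards [(hda t ht).continuousAt.eventually_ne (hint t ht).2.2.ne'] with s hs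
      using hN1 s hs
  have hioo : Ioo p q ⊆ Icc 0 b := Ioo_subset_Icc_self.trans hsub
  obtain ⟨ν₁, ν₂, τ, hlt, hor, hτ, hτN, hτi, hτc, hτd⟩ := exists_inverse_of_deriv_ne_zero hpq hNc hNd
    ((hGc.mono hioo).div ((hac.mono hioo).pow 2) fun t ht => pow_ne_zero 2 (hint t ht).2.2.ne')
    (fun t ht => div_ne_zero (left_ne_zero_of_mul (hne t ht)) (pow_ne_zero 2 (hint t ht).2.2.ne'))
  have hNmem : ∀ t ∈ Icc p q, N t ∈ Icc 0 νs := fun t ht => by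
    by_cases h : a t = 0
    · obtain rfl := hazero t ht h
      obtain ⟨-, h1, h2, -⟩ := hslope ht h
      rw [show N 0 = (a' 0)⁻¹ by simp [hN, h]]
      exact ⟨(inv_pos.2 h1).le, (inv_le_iff_one_le_mul₀ h1).2 h2⟩
    · have h1 : 0 < a t := lt_of_le_of_ne (hann t ht) (Ne.symm h)
      have h2 := hgnn t ht
      rw [hN1 t h]
      refine ⟨div_nonneg (hsub ht).1 h1.le, (div_le_iff₀ h1).2 ?_⟩
      simp only [hg] at h2; linarith
  have hNfix : ∀ t ∈ Icc p q, t = N t * a t := fun t ht => by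
    by_cases h : a t = 0
    · rw [h, mul_zero]; exact hazero t ht h
    · rw [hN1 t h, div_mul_cancel₀ _ h]
  have hNt₀ : N t₀ = ν₀ := by
    rw [hN1 t₀ hat₀.ne']
    exact (div_eq_iff hat₀.ne').2 hfix
  -- If `a t = 0`, then `t = 0` and the chosen value of `N` satisfies `N t * a' t = 1`. Otherwise `t
  -- = 0`, `g = 0` and `G = 0` give the three outcomes in turn.
  have hend : ∀ t ∈ Icc p q, (t = 0 ∨ G t * g t = 0) → N t = 0 ∨ N t = νs ∨ N t * a' t = 1 := by
    intro t ht h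
    by_cases h0 : a t = 0
    · obtain rfl := hazero t ht h0
      obtain ⟨-, h1, -, -⟩ := hslope ht h0
      refine Or.inr (Or.inr ?_)
      rw [show N 0 = (a' 0)⁻¹ by simp [hN, h0], inv_mul_cancel₀ h1.ne']
    · rw [hN1 t h0]
      rcases h with rfl | h
      · exact Or.inl (zero_div _)
      rcases mul_eq_zero.1 h with h | h <;> simp only [hG, hg] at h
      · refine Or.inr (Or.inr ?_)
        rw [div_mul_eq_mul_div, div_eq_one_iff_eq h0]
        linarith
      · refine Or.inr (Or.inl ?_)
        rw [div_eq_iff h0]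
        linarith
  have hpm : p ∈ Icc p q := left_mem_Icc.2 hpq.le
  have hqm : q ∈ Icc p q := right_mem_Icc.2 hpq.le
  have hνend : ∀ ν ∈ Icc ν₁ ν₂, ν = N p ∨ ν = N q → ν = 0 ∨ ν = νs ∨ ν * a' (τ ν) = 1 := by
    intro ν hν h
    obtain ⟨h1, h2⟩ := hτ ν hν
    have h3 : τ ν = p ∨ τ ν = q := by
      by_contra hcon
      rw [not_or] at hcon
      have h4 := (hτN (τ ν) ⟨lt_of_le_of_ne h1.1 (Ne.symm hcon.1), lt_of_le_of_ne h1.2 hcon.2⟩).1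
      rw [h2] at h4
      rcases h with rfl | rfl <;> rcases hor with ⟨e1, e2⟩ | ⟨e1, e2⟩ <;>
        simp [e1, e2] at h4
    have h5 := hend (τ ν) h1 (h3.elim (fun h => by rw [h]; exact hp0)
      fun h => Or.inr (by rw [h]; exact hq0))
    rwa [h2] at h5
  have hm₁ : ν₁ ∈ Icc ν₁ ν₂ := left_mem_Icc.2 hlt.le
  have hm₂ : ν₂ ∈ Icc ν₁ ν₂ := right_mem_Icc.2 hlt.le
  have hν₁ : ν₁ ∈ Icc 0 νs := (hτ ν₁ hm₁).2 ▸ hNmem _ (hτ ν₁ hm₁).1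
  have hν₂ : ν₂ ∈ Icc 0 νs := (hτ ν₂ hm₂).2 ▸ hNmem _ (hτ ν₂ hm₂).1
  refine ⟨ν₁, ν₂, τ, Icc_subset_Icc hν₁.1 hν₂.2, hNt₀ ▸ (hτN t₀ ⟨hpt, htq⟩).1,
    hNt₀ ▸ (hτN t₀ ⟨hpt, htq⟩).2, hτc, hτd, fun ν hν => ?_, fun ν hν h => ?_, ?_, ?_⟩
  · obtain ⟨h1, h2⟩ := hτ ν hν
    refine ⟨hsub h1, ?_⟩
    have := hNfix (τ ν) h1
    rwa [h2] at this
  · obtain ⟨h1, h2⟩ := hτ ν (Ioo_subset_Icc_self hν)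
    have h3 := hNfix (τ ν) h1
    rw [h2] at h3
    refine left_ne_zero_of_mul (hne _ (hτi ν hν)) ?_
    simp only [hG]
    linear_combination a (τ ν) * (-h) - a' (τ ν) * h3
  -- The lower end cannot be `νs`, since `ν₁ < ν₂ ≤ νs`; symmetrically, the upper end cannot be `0`.
  · rcases hνend ν₁ hm₁ (by tauto) with h | h | h
    · exact Or.inl h
    · exact absurd (h ▸ hlt) hν₂.2.not_gt
    · exact Or.inr h
  · rcases hνend ν₂ hm₂ (by tauto) with h | h | h
    · exact absurd (h ▸ hlt) hν₁.1.not_gt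
    · exact Or.inl h
    · exact Or.inr h

/-- A regular solution of `t = ν a(t)` lies on a maximal `C^1` branch. -/
lemma exists_maximal_branch {b c νs ν₀ t₀ : ℝ} {a a' : ℝ → ℝ} (h0 : (0 : ℝ) ∈ Icc c b)
    (hd : ∀ t ∈ Icc c b, HasDerivWithinAt a (a' t) (Icc c b) t) (ha' : ContinuousOn a' (Icc c b))
    (hmap : ∀ t ∈ Icc c b, νs * a t ∈ Icc c b) (hν₀ : ν₀ ∈ Ioo 0 νs) (ht₀ : t₀ ∈ Icc c b)
    (hfix : t₀ = ν₀ * a t₀) (hreg : ν₀ * a' t₀ ≠ 1) :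
    HasMaximalBranch (Icc c b) νs a a' ν₀ t₀ := by
  have hmono : ∀ {J J' : Set ℝ} {a a' t₀}, J ⊆ J' → HasMaximalBranch J νs a a' ν₀ t₀ →
      HasMaximalBranch J' νs a a' ν₀ t₀ := by
    rintro J J' a a' t₀ hJ ⟨ν₁, ν₂, τ, h1, h2, h3, h4, h5, h6, h⟩
    exact ⟨ν₁, ν₂, τ, h1, h2, h3, h4, h5, fun ν hν => ⟨hJ (h6 ν hν).1, (h6 ν hν).2⟩, h⟩
  have hcb : c ≤ b := h0.1.trans h0.2
  rcases lt_trichotomy t₀ 0 with h | rfl | h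
  · refine HasMaximalBranch.neg (hmono (J := Icc 0 (-c)) (fun t ht => ?_)
      (hasMaximalBranch_of_pos ?_ ?_ ?_ hν₀ (neg_pos.2 h) (neg_le_neg ht₀.1) ?_ ?_))
    · exact ⟨by linarith [ht.2], by linarith [ht.1, h0.2]⟩
    · intro t ht
      have hm : MapsTo Neg.neg (Icc 0 (-c)) (Icc c b) := fun s hs =>
        ⟨by linarith [hs.2], by linarith [hs.1, h0.2]⟩
      have h1 := ((hd (-t) (hm ht)).comp t ((hasDerivAt_neg t).hasDerivWithinAt) hm).neg
      exact h1.congr_deriv (by ring)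
    · exact ha'.comp continuousOn_neg fun s hs => ⟨by linarith [hs.2], by linarith [hs.1, h0.2]⟩
    · have := (hmap c ⟨le_rfl, hcb⟩).1
      simp only [neg_neg]; linarith
    · simp only [neg_neg]; linarith
    · simpa using hreg
  · refine hasMaximalBranch_zero h0 hν₀ ?_ hreg
    exact (mul_eq_zero.1 hfix.symm).resolve_left hν₀.1.ne'
  · have hs : Icc 0 b ⊆ Icc c b := Icc_subset_Icc_left h0.1
    exact hmono hs (hasMaximalBranch_of_pos (fun t ht => (hd t (hs ht)).mono hs) (ha'.mono hs)
      (hmap b ⟨hcb, le_rfl⟩).2 hν₀ h ht₀.2 hfix hreg)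

/-! ### Return to the coupled maps -/

namespace Scale

variable {B : Fin 4 → Type*} [∀ i, NormedAddCommGroup (B i)] [∀ i, NormedSpace ℝ (B i)]
variable {X : Scale d r B} {M : Model d}

/-- Positivity alone puts `∫ α h` between the minimum and maximum of `α`, so `h` need not be
represented by a measure. -/
lemma mul_intα_mem_params {νstar ν : ℝ} (hν : ν ∈ Icc 0 νstar) {h : B 1} (h0 : X.Nonneg 1 h)
    (h1 : X.int 1 h = 1) : ν * X.intα M h ∈ M.params νstar := by
  have hone : X.emb 1 h Cr.one = 1 := h1
  obtain ⟨x, -, hx⟩ := isCompact_univ.exists_isMinOn univ_nonempty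
    (CFun.continuous M.α).continuousOn
  obtain ⟨y, -, hy⟩ := isCompact_univ.exists_isMaxOn univ_nonempty
    (CFun.continuous M.α).continuousOn
  have hl := h0 (Cr.ofSmooth M.α - M.α.1 x • Cr.one) fun z => by
    show 0 ≤ M.α.1 z - M.α.1 x * 1
    rw [mul_one]
    exact sub_nonneg.2 (hx (mem_univ z))
  have hu := h0 (M.α.1 y • Cr.one - Cr.ofSmooth M.α) fun z => by
    show 0 ≤ M.α.1 y * 1 - M.α.1 z
    rw [mul_one]
    exact sub_nonneg.2 (hy (mem_univ z))
  rw [map_sub, map_smul, hone, smul_eq_mul, mul_one] at hl hu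
  exact Model.mul_mem_params hν (sub_nonneg.1 hl) (sub_nonneg.1 hu)

lemma isFixed_iff {𝒯 : Set (TorusMap d r)} {K C c₁ c₂ ϑ : ℝ} (hX : X.Assumptions 𝒯 K C c₁ c₂ ϑ)
    {ν : ℝ} {h : B 1} (hS : M.shift r (ν * X.intα M h) ∈ 𝒯) :
    X.IsFixed M ν h ↔ X.transfer 1 (M.shift r (ν * X.intα M h)) h = h := by
  rw [IsFixed, map, Model.coupledMap_eq_shift]
  simp only [← hX.emb_transfer hS]
  exact ⟨fun H => X.emb_injective 1 (ContinuousLinearMap.ext H), fun H g => by rw [H]⟩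

end Scale

end MeanFieldMaps

end

theorem mainTheorem8 {d r : ℕ} (hr : 12 < r)
    (M : MeanFieldMaps.Model d)
    (𝒯 : Set (MeanFieldMaps.TorusMap d r)) (νstar : ℝ) (hνstar : 0 < νstar)
    (h𝒯 : M.Admissible 𝒯 νstar)
    {B : Fin 4 → Type*} [∀ i, NormedAddCommGroup (B i)] [∀ i, NormedSpace ℝ (B i)]
    [∀ i, CompleteSpace (B i)]
    (X : MeanFieldMaps.Scale d r B)
    (K C c₁ c₂ ϑ : ℝ) (hX : X.Assumptions 𝒯 K C c₁ c₂ ϑ) :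
    ∃ K₀ : ℝ, 0 < K₀ ∧ ∀ Kstar : ℝ, K₀ ≤ Kstar →
      ∀ ν₀ ∈ Ioo (0 : ℝ) νstar, ∀ h₀ ∈ X.W Kstar,
        X.IsFixed M ν₀ h₀ → ν₀ * X.intα M (X.Theta M ν₀ h₀) ≠ 1 →
        ∃ (ν₁ ν₂ : ℝ) (hcurve : ℝ → B 1),
          Icc ν₁ ν₂ ⊆ Icc 0 νstar ∧ ν₀ ∈ Ioo ν₁ ν₂ ∧ hcurve ν₀ = h₀ ∧
          ContinuousOn hcurve (Icc ν₁ ν₂) ∧ ContDiffOn ℝ 1 hcurve (Ioo ν₁ ν₂) ∧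
          (∀ ν ∈ Icc ν₁ ν₂, hcurve ν ∈ X.W Kstar ∧ X.IsFixed M ν (hcurve ν)) ∧
          (∀ ν ∈ Ioo ν₁ ν₂, ν * X.intα M (X.Theta M ν (hcurve ν)) ≠ 1) ∧
          (ν₁ = 0 ∨ ν₁ * X.intα M (X.Theta M ν₁ (hcurve ν₁)) = 1) ∧
          (ν₂ = νstar ∨ ν₂ * X.intα M (X.Theta M ν₂ (hcurve ν₂)) = 1) := by
  open MeanFieldMaps MeanFieldMaps.Scale in
  obtain ⟨c, b, -, hJ⟩ := Model.params_eq_Icc (M := M) hνstar.le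
  have hS : ∀ t ∈ Icc c b, M.shift r t ∈ 𝒯 := fun t ht => h𝒯.shift_mem (hJ ▸ ht)
  have h0 : (0 : ℝ) ∈ Icc c b := hJ ▸ Model.zero_mem_params hνstar.le
  obtain ⟨c₀, hquad⟩ := hX.linear_response (convex_Icc c b) hS
  obtain ⟨hd, hΘ⟩ := contDiff_of_quadratic_estimate hquad
  have hmc : ContinuousOn (X.invMeasure₁ M) (Icc c b) := fun t ht => (hd t ht).continuousWithinAt
  have hm1 := contDiffOn_one_of_hasDerivWithinAt hd hΘ
  obtain ⟨b₀, hb₀⟩ := isCompact_Icc.exists_bound_of_continuousOn hmc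
  -- All the fixed points are among the `m(t)` with `t` in a compact interval. Their norms are at
  -- most `b₀`, so the norm constraint of `W` never ends the branch; the `1` only ensures
  -- positivity.
  refine ⟨max b₀ 1, by positivity, fun Kstar hK ν₀ hν₀ h₀ hh₀ hfix hreg => ?_⟩
  obtain ⟨-, hpos, hone⟩ := hh₀
  have ht₀ : ν₀ * X.intα M h₀ ∈ Icc c b :=
    hJ ▸ mul_intα_mem_params (Ioo_subset_Icc_self hν₀) hpos hone
  have hh₀ : h₀ = X.invMeasure₁ M (ν₀ * X.intα M h₀) :=
    hX.eq_invMeasure₁ (hS _ ht₀) hone ((isFixed_iff hX (hS _ ht₀)).1 hfix)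
  let ℓ : B 1 →L[ℝ] ℝ := (X.emb 1).flip (Cr.ofSmooth M.α)
  rw [Theta_eq] at hreg
  obtain ⟨ν₁, ν₂, τ, h1, h2, h3, h4, h5, h6, h7, h8, h9⟩ :=
    exists_maximal_branch (a := fun t => X.intα M (X.invMeasure₁ M t))
      (a' := fun t => X.intα M (X.response M t)) h0
      (fun t ht => ℓ.hasFDerivAt.comp_hasDerivWithinAt t (hd t ht))
      (ℓ.continuous.comp_continuousOn hΘ)
      -- Since `m(t)` is itself a probability, `νstar * a t` is again a parameter; this supplies the
      -- sign conditions at the ends of the parameter interval.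
      (fun t ht => hJ ▸ mul_intα_mem_params (right_mem_Icc.2 hνstar.le)
        (hX.nonneg_invMeasure₁ (hS t ht)) (hX.int_invMeasure₁ (hS t ht)))
      hν₀ ht₀ (congrArg (fun h => ν₀ * X.intα M h) hh₀) hreg
  have h12 : ν₁ < ν₂ := h2.1.trans h2.2
  have hmaps : MapsTo τ (Icc ν₁ ν₂) (Icc c b) := fun ν hν => (h6 ν hν).1
  have hτ : ∀ ν ∈ Icc ν₁ ν₂, ν * X.intα M (X.invMeasure₁ M (τ ν)) = τ ν := fun ν hν =>
    (h6 ν hν).2.symm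
  have hTheta : ∀ ν ∈ Icc ν₁ ν₂,
      X.Theta M ν (X.invMeasure₁ M (τ ν)) = X.response M (τ ν) := fun ν hν => by
    rw [Theta_eq, hτ ν hν]
  refine ⟨ν₁, ν₂, fun ν => X.invMeasure₁ M (τ ν), h1, h2, ?_, hmc.comp h4 hmaps,
    hm1.comp h5 (hmaps.mono_left Ioo_subset_Icc_self), fun ν hν => ⟨⟨?_, ?_, ?_⟩, ?_⟩,
    fun ν hν => ?_, ?_, ?_⟩
  · simp only [h3]; exact hh₀.symm
  · exact (hb₀ _ (hmaps hν)).trans ((le_max_left _ _).trans hK)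
  · exact hX.nonneg_invMeasure₁ (hS _ (hmaps hν))
  · exact hX.int_invMeasure₁ (hS _ (hmaps hν))
  · have hSν := hS _ (hmaps hν)
    rw [isFixed_iff hX (by rwa [hτ ν hν]), hτ ν hν]
    exact hX.transfer_invMeasure₁ hSν
  · simp only [hTheta ν (Ioo_subset_Icc_self hν)]; exact h7 ν hν
  · simp only [hTheta ν₁ (left_mem_Icc.2 h12.le)]; exact h8
  · simp only [hTheta ν₂ (right_mem_Icc.2 h12.le)]; exact h9
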